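/- Let $\mu$ be a measure on $\mathbb{R}$ with finite moments of all orders and infinite support, let $p_n$ ($n\ge 0$) be its orthonormal polynomials ($\deg p_n=n$, positive leading coefficient, $\int p_mp_n\,d\mu=\delta_{mn}$), and let $\{a_n,b_n\}_{n=1}^\infty$ be its Jacobi parameters, defined by $$x\,p_n(x)=a_{n+1}p_{n+1}(x)+b_{n+1}p_n(x)+a_np_{n-1}(x),\qquad n\ge 0,\quad p_{-1}\equiv 0 .$$ Suppose that $$\lim_{n\to\infty}a_n=1,\qquad \lim_{n\to\infty}b_n=0,\qquad \sum_{n=1}^\infty\bigl(|a_{n+1}-a_n|+|b_{n+1}-b_n|\bigr)<\infty .$$ Then: (1) The density of states exists and is the free one: the probability measures $\nu_n$ giving weight $1/n$ to each of the $n$ zeros of $p_n$ converge weakly, as $n\to\infty$, to $$d\nu(x)=\frac{1}{\pi\sqrt{4-x^2}}\,\chi_{[-2,2]}(x)\,dx .$$ (2) For every $\varepsilon>0$ there is uniform clock behavior on $[-2+\varepsilon,2-\varepsilon]$: the symmetric derivative $\rho=d\nu/dE$ exists, is continuous and does not vanish on $[-2+\varepsilon,2-\varepsilon]$, and $$\lim_{n\to\infty}\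 \sup\Bigl\{\,\bigl|\,n(E-E')-\rho(x)^{-1}\bigr|\ :\ E'<E \text{ successive zeros of } p_n \text{ in } [-2+\varepsilon,2-\varepsilon],\ x\in[E',E]\Bigr\}=0$$ (the supremum of the empty set being $0$). -/

import Mathlib

open Filter Topology MeasureTheory Polynomial
open scoped BoundedContinuousFunction

/-- `p` is the sequence of orthonormal polynomials of the measure `μ` on the real line: `μ` has
finite moments of all orders, `p n` has degree `n` and positive leading coefficient, and
`∫ p_m p_n dμ = δ_{mn}`. (In particular `μ` cannot have finite support.) -/
structure IsOrthonormalPolynomials (μ : Measure ℝ) (p : ℕ → ℝ[X]) : Prop where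
  moments : ∀ k : ℕ, Integrable (fun x : ℝ => x ^ k) μ
  natDegree_eq : ∀ n, (p n).natDegree = n
  leadingCoeff_pos : ∀ n, 0 < (p n).leadingCoeff
  orthonormal : ∀ m n, ∫ x, (p m).eval x * (p n).eval x ∂μ = if m = n then 1 else 0

/-- `a₁, a₂, …` and `b₁, b₂, …` are the Jacobi parameters of the orthonormal polynomials `p`:
`x p_n = a_{n+1} p_{n+1} + b_{n+1} p_n + a_n p_{n-1}` for `n ≥ 0`, with `p_{-1} = 0`.
The values `a 0` and `b 0` play no role. -/
structure IsJacobiParameters (p : ℕ → ℝ[X]) (a b : ℕ → ℝ) : Prop where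
  rec_zero : X * p 0 = C (a 1) * p 1 + C (b 1) * p 0
  rec_succ : ∀ n, X * p (n + 1) =
    C (a (n + 2)) * p (n + 2) + C (b (n + 2)) * p (n + 1) + C (a (n + 1)) * p n

/-- The measure giving weight `1/n` to each real zero of `p n` (counted with multiplicity). -/
noncomputable def zeroMeasure (p : ℕ → ℝ[X]) (n : ℕ) : Measure ℝ :=
  (n : ENNReal)⁻¹ • ((p n).roots.map Measure.dirac).sum

/-- The density of states of `p` exists and equals `ν`: the zero measures converge weakly to the
probability measure `ν`. -/
def IsDensityOfStates (p : ℕ → ℝ[X]) (ν : Measure ℝ) : Prop :=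
  IsProbabilityMeasure ν ∧
    ∀ f : ℝ →ᵇ ℝ, Tendsto (fun n => ∫ x, f x ∂(zeroMeasure p n)) atTop (𝓝 (∫ x, f x ∂ν))

/-- The free density of states `π⁻¹ (4 - x²)^{-1/2} χ_{[-2,2]} dx`. -/
noncomputable def freeDensityOfStates : Measure ℝ :=
  (volume.restrict (Set.Icc (-2) 2)).withDensity
    (fun x => ENNReal.ofReal (Real.pi⁻¹ * (Real.sqrt (4 - x ^ 2))⁻¹))

/-- The symmetric derivative `dν/dE` exists at `E` and equals `d`. -/
def HasSymmDensityAt (ν : Measure ℝ) (d E : ℝ) : Prop :=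
  Tendsto (fun δ : ℝ => ν.real (Set.Ioo (E - δ) (E + δ)) / (2 * δ)) (𝓝[>] 0) (𝓝 d)

/-- `E' < E` are successive zeros of the polynomial `q` in `[α, β]`. -/
def AreSuccessiveZeros (q : ℝ[X]) (α β E' E : ℝ) : Prop :=
  E' ∈ Set.Icc α β ∧ E ∈ Set.Icc α β ∧ E' < E ∧ q.IsRoot E' ∧ q.IsRoot E ∧
    ∀ x ∈ Set.Ioo E' E, ¬ q.IsRoot x

/-- Uniform clock behavior on `[α, β]` of the zeros of `p n`, relative to the density of states
`ν`: the derivative `ρ = dν/dE` exists, is continuous and does not vanish on `[α, β]`, and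
`|n (E - E') - ρ⁻¹|` tends to `0` as `n → ∞` uniformly over all successive zeros `E' < E` of `p n`
in `[α, β]`; here `ρ` may be evaluated at any point of `[E', E]`. -/
def UniformClockBehavior (p : ℕ → ℝ[X]) (ν : Measure ℝ) (α β : ℝ) : Prop :=
  ∃ ρ : ℝ → ℝ,
    (∀ E ∈ Set.Icc α β, HasSymmDensityAt ν (ρ E) E) ∧
    ContinuousOn ρ (Set.Icc α β) ∧
    (∀ E ∈ Set.Icc α β, ρ E ≠ 0) ∧
    ∀ η : ℝ, 0 < η → ∃ N : ℕ, ∀ n ≥ N, ∀ E' E : ℝ, AreSuccessiveZeros (p n) α β E' E →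
      ∀ x ∈ Set.Icc E' E, |(n : ℝ) * (E - E') - (ρ x)⁻¹| < η

/-! Write the recursion with `A n = a (n + 1)`, `B n = b (n + 1)`, and set w_n = P_{n+1} -
exp(-iθ_n) P_n with 2 cos θ_n = (x - B n) / A n. For constant coefficients w_{n+1} = exp(iθ) w_n. In
general the error is O(|ΔA| + |ΔB|) |P_n|, and |P_n| ≤ |w_n| / sin θ_n because Im w_n = sin θ_n ·
P_n. Hence w_n = F_n exp(iΦ_n), where Φ_n is a sum of angles and F_n has summable relative
increments, uniformly on compact subintervals of (-2, 2). So F_n stays relatively close to one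
continuous nonvanishing function, and is almost constant on short intervals
(`jacobiAmplitude_relatively_equicontinuous`).

Zeros of P_n are the points where F_n exp(iΦ_n) is real. Since Φ_n decreases with slope about -n /
√(4 - x²), the relevant scale is 1/n, where F_n is constant to leading order. A phase drop exceeding
π forces a zero. Conversely w_n = P_{n+1} at a zero, and P_{n+1} changes sign between successive
zeros by the positive Christoffel–Darboux kernel, so the drop there is nearly π. The spacing is thus
about π √(4 - x²) / n (`eventually_clock`).

The same winding bounds the number of zeros in (c, d) from below by n ν(c, d) up to o(n)
(`eventually_exists_zeros`). Lower bounds suffice for weak convergence, since ν has mass one and the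
zero measures have mass at most one. -/

/-! ### Phase and amplitude of a solution of the Jacobi recursion. -/

/-- The cosine `(x - B n) / (2 A n)` of the local phase increment of the Jacobi recursion. -/
noncomputable def jacobiCos (A B : ℕ → ℝ) (n : ℕ) (x : ℝ) : ℝ := (x - B n) / (2 * A n)

/-- The local phase increment of the Jacobi recursion. -/
noncomputable def jacobiAngle (A B : ℕ → ℝ) (n : ℕ) (x : ℝ) : ℝ := Real.arccos (jacobiCos A B n x)

/-- The accumulated phase of the Jacobi recursion between the indices `N` and `n`. -/
noncomputable def jacobiPhase (A B : ℕ → ℝ) (N n : ℕ) (x : ℝ) : ℝ :=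
  ∑ j ∈ Finset.Ico N n, jacobiAngle A B (j + 1) x

/-- The complex combination `P (n+1) - exp (-i θ) P n` of two consecutive solutions. -/
noncomputable def jacobiWave (A B : ℕ → ℝ) (P : ℕ → ℝ → ℝ) (n : ℕ) (x : ℝ) : ℂ :=
  P (n + 1) x - Complex.exp (-(jacobiAngle A B n x) * Complex.I) * P n x

/-- The wave with its accumulated phase removed. -/
noncomputable def jacobiAmplitude (A B : ℕ → ℝ) (P : ℕ → ℝ → ℝ) (N n : ℕ) (x : ℝ) : ℂ :=
  jacobiWave A B P n x * Complex.exp (-(jacobiPhase A B N n x) * Complex.I)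

lemma continuous_jacobiAngle (A B : ℕ → ℝ) (n : ℕ) : Continuous (jacobiAngle A B n) := by
  unfold jacobiAngle jacobiCos
  exact Real.continuous_arccos.comp (by fun_prop)

lemma continuous_jacobiPhase (A B : ℕ → ℝ) (N n : ℕ) : Continuous (jacobiPhase A B N n) :=
  continuous_finsetSum _ fun _ _ => continuous_jacobiAngle A B _

lemma continuous_jacobiWave {A B : ℕ → ℝ} {P : ℕ → ℝ → ℝ} (hP : ∀ n, Continuous (P n)) (n : ℕ) :
    Continuous (jacobiWave A B P n) := by
  have := hP n
  have := hP (n + 1)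
  have := continuous_jacobiAngle A B n
  unfold jacobiWave
  fun_prop

lemma continuous_jacobiAmplitude {A B : ℕ → ℝ} {P : ℕ → ℝ → ℝ} (hP : ∀ n, Continuous (P n))
    (N n : ℕ) : Continuous (jacobiAmplitude A B P N n) := by
  have := continuous_jacobiWave (A := A) (B := B) hP n
  have := continuous_jacobiPhase A B N n
  unfold jacobiAmplitude
  fun_prop

lemma norm_exp_neg_mul_I (t : ℝ) : ‖Complex.exp (-t * Complex.I)‖ = 1 := by
  rw [← Complex.ofReal_neg, Complex.norm_exp_ofReal_mul_I]

lemma exp_neg_mul_I (t : ℝ) :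
    Complex.exp (-t * Complex.I) = Real.cos t - Real.sin t * Complex.I := by
  rw [Complex.exp_mul_I, Complex.cos_neg, Complex.sin_neg]
  push_cast
  ring

lemma norm_jacobiAmplitude (A B : ℕ → ℝ) (P : ℕ → ℝ → ℝ) (N n : ℕ) (x : ℝ) :
    ‖jacobiAmplitude A B P N n x‖ = ‖jacobiWave A B P n x‖ := by
  rw [jacobiAmplitude, norm_mul, norm_exp_neg_mul_I, mul_one]

lemma jacobiWave_eq_amplitude_mul (A B : ℕ → ℝ) (P : ℕ → ℝ → ℝ) (N n : ℕ) (x : ℝ) :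
    jacobiWave A B P n x =
      jacobiAmplitude A B P N n x * Complex.exp (jacobiPhase A B N n x * Complex.I) := by
  rw [jacobiAmplitude, mul_assoc, ← Complex.exp_add]
  simp

lemma jacobiWave_im (A B : ℕ → ℝ) (P : ℕ → ℝ → ℝ) (n : ℕ) (x : ℝ) :
    (jacobiWave A B P n x).im = Real.sin (jacobiAngle A B n x) * P n x := by
  rw [jacobiWave, exp_neg_mul_I]
  simp [-Complex.ofReal_cos, -Complex.ofReal_sin]

lemma jacobiWave_of_eq_zero {A B : ℕ → ℝ} {P : ℕ → ℝ → ℝ} {n : ℕ} {x : ℝ} (h : P n x = 0) :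
    jacobiWave A B P n x = P (n + 1) x := by
  simp [jacobiWave, h]

lemma jacobiPhase_succ (A B : ℕ → ℝ) {N n : ℕ} (h : N ≤ n) (x : ℝ) :
    jacobiPhase A B N (n + 1) x = jacobiPhase A B N n x + jacobiAngle A B (n + 1) x :=
  Finset.sum_Ico_succ_top h _

/-- The numbers exp(±iθ) are the roots of λ² - 2 cos θ · λ + 1, so the wave isolates one root; the
correction term measures only the change of the coefficients from `n` to `n + 1`. -/
lemma jacobiWave_succ {A B : ℕ → ℝ} {P : ℕ → ℝ → ℝ} {n : ℕ} {x : ℝ}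
    (hA : A (n + 1) ≠ 0) (hc : |jacobiCos A B (n + 1) x| ≤ 1)
    (hrec : A (n + 1) * P (n + 2) x = (x - B (n + 1)) * P (n + 1) x - A n * P n x) :
    Complex.exp (-(jacobiAngle A B (n + 1) x) * Complex.I) * jacobiWave A B P (n + 1) x =
      jacobiWave A B P n x +
        (Complex.exp (-(jacobiAngle A B n x) * Complex.I) -
          Complex.exp (-(jacobiAngle A B (n + 1) x) * Complex.I) * (A n / A (n + 1) : ℝ)) *
          P n x := by
  obtain ⟨h1, h2⟩ := abs_le.1 hc
  have hcos : Real.cos (jacobiAngle A B (n + 1) x) = jacobiCos A B (n + 1) x :=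
    Real.cos_arccos h1 h2
  set t := jacobiAngle A B (n + 1) x
  have hP : P (n + 2) x = 2 * Real.cos t * P (n + 1) x - A n / A (n + 1) * P n x := by
    rw [hcos, jacobiCos]
    field_simp
    linarith
  have hsc : (Real.cos t : ℂ) ^ 2 + (Real.sin t : ℂ) ^ 2 = 1 := by
    exact_mod_cast Real.cos_sq_add_sin_sq t
  unfold jacobiWave
  rw [show n + 1 + 1 = n + 2 from rfl, hP, exp_neg_mul_I t]
  push_cast
  push_cast at hsc
  linear_combination (-(P (n + 1) x : ℂ) * Complex.sin t ^ 2) * Complex.I_sq +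
    (P (n + 1) x : ℂ) * hsc

/-- The correction is proportional to `P n x`, which the imaginary part of the wave controls once
the sine is bounded below. -/
lemma norm_jacobiAmplitude_succ_sub_le {A B : ℕ → ℝ} {P : ℕ → ℝ → ℝ} {N n : ℕ} {x s D : ℝ}
    (hN : N ≤ n) (hA : A (n + 1) ≠ 0) (hc : |jacobiCos A B (n + 1) x| ≤ 1)
    (hrec : A (n + 1) * P (n + 2) x = (x - B (n + 1)) * P (n + 1) x - A n * P n x)
    (hs : 0 < s) (hsin : s ≤ Real.sin (jacobiAngle A B n x))
    (hD : ‖Complex.exp (-(jacobiAngle A B n x) * Complex.I) -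
          Complex.exp (-(jacobiAngle A B (n + 1) x) * Complex.I) * (A n / A (n + 1) : ℝ)‖ ≤ D) :
    ‖jacobiAmplitude A B P N (n + 1) x - jacobiAmplitude A B P N n x‖ ≤
      D / s * ‖jacobiAmplitude A B P N n x‖ := by
  have key : jacobiAmplitude A B P N (n + 1) x - jacobiAmplitude A B P N n x =
      (Complex.exp (-(jacobiAngle A B n x) * Complex.I) -
          Complex.exp (-(jacobiAngle A B (n + 1) x) * Complex.I) * (A n / A (n + 1) : ℝ)) *
          P n x * Complex.exp (-(jacobiPhase A B N n x) * Complex.I) := by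
    have h := jacobiWave_succ hA hc hrec
    unfold jacobiAmplitude
    rw [jacobiPhase_succ A B hN]
    push_cast
    rw [neg_add, add_mul, Complex.exp_add]
    push_cast at h
    linear_combination Complex.exp (-(jacobiPhase A B N n x) * Complex.I) * h
  rw [key, norm_mul, norm_mul, norm_exp_neg_mul_I, mul_one, Complex.norm_real, Real.norm_eq_abs,
    norm_jacobiAmplitude]
  have h1 : s * |P n x| ≤ ‖jacobiWave A B P n x‖ := by
    refine le_trans ?_ (Complex.abs_im_le_norm _)
    rw [jacobiWave_im, abs_mul]
    exact mul_le_mul_of_nonneg_right (hsin.trans (le_abs_self _)) (abs_nonneg _)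
  have hD0 : 0 ≤ D := (norm_nonneg _).trans hD
  calc _ ≤ D * |P n x| := mul_le_mul_of_nonneg_right hD (abs_nonneg _)
    _ = D / s * (s * |P n x|) := by field_simp
    _ ≤ _ := mul_le_mul_of_nonneg_left h1 (by positivity)

lemma jacobiWave_ne_zero {A B : ℕ → ℝ} {P : ℕ → ℝ → ℝ} {n : ℕ} {x : ℝ}
    (hsin : 0 < Real.sin (jacobiAngle A B n x)) (h0 : P n x = 0 → P (n + 1) x ≠ 0) :
    jacobiWave A B P n x ≠ 0 := by
  intro h
  have h1 := jacobiWave_im A B P n x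
  rw [h, Complex.zero_im, eq_comm, mul_eq_zero] at h1
  have h2 := h1.resolve_left hsin.ne'
  rw [jacobiWave_of_eq_zero h2] at h
  exact h0 h2 (by exact_mod_cast h)

/-- A sequence whose relative increments are summable stays close to its value at an index
beyond which the sum of the increments is small. -/
lemma norm_sub_le_of_relative_increments {E : Type*} [NormedAddCommGroup E] {F : ℕ → E}
    {d : ℕ → ℝ} {M : ℕ} {T : ℝ} (hd : ∀ n, 0 ≤ d n) (hT : T ≤ 1 / 2)
    (hsum : ∀ n, ∑ j ∈ Finset.Ico M n, d j ≤ T)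
    (hF : ∀ n ≥ M, ‖F (n + 1) - F n‖ ≤ d n * ‖F n‖) {n : ℕ} (hn : M ≤ n) :
    ‖F n - F M‖ ≤ 2 * T * ‖F M‖ := by
  have key : ‖F n - F M‖ ≤ 2 * (∑ j ∈ Finset.Ico M n, d j) * ‖F M‖ := by
    induction n, hn using Nat.le_induction with
    | base => simp
    | succ n hn ih =>
      rw [Finset.sum_Ico_succ_top hn]
      -- As `T ≤ 1 / 2`, the induction hypothesis keeps `‖F n‖` within twice `‖F M‖`, so the next
      -- increment costs at most `2 * d n * ‖F M‖`.
      have h1 : ‖F n‖ ≤ 2 * ‖F M‖ := by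
        have h2 : ‖F n‖ ≤ ‖F n - F M‖ + ‖F M‖ := by simpa using norm_add_le (F n - F M) (F M)
        have h3 := hsum n
        have h4 : 0 ≤ ‖F M‖ := norm_nonneg _
        nlinarith
      have h2 : ‖F (n + 1) - F M‖ ≤ ‖F (n + 1) - F n‖ + ‖F n - F M‖ := by
        simpa using norm_add_le (F (n + 1) - F n) (F n - F M)
      have h3 := hF n hn
      have h4 := mul_le_mul_of_nonneg_left h1 (hd n)
      nlinarith
  refine key.trans ?_
  gcongr
  exact hsum n

/-! ### Uniform estimates on compact subintervals of (-2, 2). -/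

lemma eventually_abs_jacobiCos_sub_le {A B : ℕ → ℝ} (hA : Tendsto A atTop (𝓝 1))
    (hB : Tendsto B atTop (𝓝 0)) (α β : ℝ) {r : ℝ} (hr : 0 < r) :
    ∀ᶠ n in atTop, ∀ x ∈ Set.Icc α β, |jacobiCos A B n x - x / 2| ≤ r := by
  set K := max |α| |β| with hK
  have h1 : Tendsto (fun n => K * |1 - A n| + |B n|) atTop (𝓝 0) := by
    have := ((hA.const_sub 1).abs.const_mul K).add hB.abs
    simpa using this
  filter_upwards [h1.eventually_lt_const hr, hA.eventually_const_lt (by norm_num : (1 / 2 : ℝ) < 1)]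
    with n hn hn' x hx
  have hx' : |x| ≤ K := abs_le_max_abs_abs hx.1 hx.2
  have e : jacobiCos A B n x - x / 2 = (x * (1 - A n) - B n) / (2 * A n) := by
    rw [jacobiCos]
    field_simp
    ring
  rw [e, abs_div, abs_of_pos (by linarith : 0 < 2 * A n), div_le_iff₀ (by linarith)]
  have h2 : |x * (1 - A n) - B n| ≤ |x| * |1 - A n| + |B n| := by
    rw [← abs_mul]
    exact abs_sub _ _
  have h3 := mul_le_mul_of_nonneg_right hx' (abs_nonneg (1 - A n))
  nlinarith

lemma exists_eventually_abs_jacobiCos_le {A B : ℕ → ℝ} (hA : Tendsto A atTop (𝓝 1))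
    (hB : Tendsto B atTop (𝓝 0)) {α β : ℝ} (hα : -2 < α) (hβ : β < 2) :
    ∃ k : ℝ, 0 < k ∧ k < 1 ∧ (∀ x ∈ Set.Icc α β, |x / 2| ≤ k) ∧
      ∀ᶠ n in atTop, ∀ x ∈ Set.Icc α β, |jacobiCos A B n x| ≤ k := by
  set m := max 0 (max (-α / 2) (β / 2)) with hm
  have hm0 : 0 ≤ m := le_max_left _ _
  have hm1 : m < 1 := by
    rw [hm]
    refine max_lt one_pos (max_lt ?_ ?_) <;> linarith
  have hx2 : ∀ x ∈ Set.Icc α β, |x / 2| ≤ m := by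
    intro x hx
    have h1 : -α / 2 ≤ m := (le_max_left _ _).trans (le_max_right _ _)
    have h2 : β / 2 ≤ m := (le_max_right _ _).trans (le_max_right _ _)
    rw [abs_le]
    constructor <;> linarith [hx.1, hx.2]
  -- The midpoint of `m` and 1 leaves room `(1 - m) / 2` for the difference between `jacobiCos` and
  -- `x / 2`.
  refine ⟨(1 + m) / 2, by linarith, by linarith, fun x hx => (hx2 x hx).trans (by linarith), ?_⟩
  filter_upwards [eventually_abs_jacobiCos_sub_le hA hB α β (by linarith : 0 < (1 - m) / 2)]
    with n hn x hx
  have h1 := hn x hx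
  have h2 := hx2 x hx
  have h3 := abs_add_le (jacobiCos A B n x - x / 2) (x / 2)
  rw [sub_add_cancel] at h3
  linarith

lemma sqrt_one_sub_sq_le {k c : ℝ} (hc : |c| ≤ k) : √(1 - k ^ 2) ≤ √(1 - c ^ 2) := by
  apply Real.sqrt_le_sqrt
  have := sq_le_sq' (by linarith [neg_abs_le c, abs_nonneg c]) ((le_abs_self c).trans hc)
  linarith

lemma abs_sqrt_one_sub_sq_sub_le {k c d : ℝ} (hk : k < 1) (hc : |c| ≤ k) (hd : |d| ≤ k) :
    |√(1 - c ^ 2) - √(1 - d ^ 2)| ≤ |c - d| / √(1 - k ^ 2) := by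
  have hk0 : 0 ≤ k := (abs_nonneg c).trans hc
  have hs : 0 < √(1 - k ^ 2) := Real.sqrt_pos.2 (by nlinarith)
  have h1 := sqrt_one_sub_sq_le hc
  have h2 := sqrt_one_sub_sq_le hd
  have hc2 : c ^ 2 ≤ 1 := by
    rw [sq_le_one_iff_abs_le_one]
    linarith
  have hd2 : d ^ 2 ≤ 1 := by
    rw [sq_le_one_iff_abs_le_one]
    linarith
  have e : (√(1 - c ^ 2) - √(1 - d ^ 2)) * (√(1 - c ^ 2) + √(1 - d ^ 2)) = (d - c) * (d + c) := by
    have e1 := Real.sq_sqrt (by linarith : 0 ≤ 1 - c ^ 2)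
    have e2 := Real.sq_sqrt (by linarith : 0 ≤ 1 - d ^ 2)
    linear_combination e1 - e2
  have e' := congrArg abs e
  rw [abs_mul, abs_mul, abs_of_pos (by linarith : 0 < √(1 - c ^ 2) + √(1 - d ^ 2)),
    abs_sub_comm d c] at e'
  rw [le_div_iff₀ hs]
  have h3 : |d + c| ≤ 2 := (abs_add_le d c).trans (by linarith)
  have h4 := abs_nonneg (√(1 - c ^ 2) - √(1 - d ^ 2))
  have h5 := abs_nonneg (c - d)
  nlinarith

lemma abs_jacobiCos_succ_sub_le {A B : ℕ → ℝ} {n : ℕ} {x : ℝ} (h1 : 1 / 2 ≤ A n)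
    (h2 : 1 / 2 ≤ A (n + 1)) (hc : |jacobiCos A B n x| ≤ 1) :
    |jacobiCos A B n x - jacobiCos A B (n + 1) x| ≤
      2 * (|A (n + 1) - A n| + |B (n + 1) - B n|) := by
  have e : jacobiCos A B n x - jacobiCos A B (n + 1) x =
      (jacobiCos A B n x * (2 * (A (n + 1) - A n)) + (B (n + 1) - B n)) / (2 * A (n + 1)) := by
    unfold jacobiCos
    field_simp
    ring
  rw [e, abs_div, abs_of_pos (by linarith : 0 < 2 * A (n + 1)), div_le_iff₀ (by linarith)]
  refine (abs_add_le _ _).trans ?_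
  rw [abs_mul, abs_mul, abs_two]
  have h3 := abs_nonneg (A (n + 1) - A n)
  have h4 := abs_nonneg (B (n + 1) - B n)
  have h5 := mul_le_mul_of_nonneg_right hc h3
  nlinarith

/-- The cosine difference and `1 - A n / A (n + 1)` contribute 2 each; the sine difference
contributes `2 / √(1 - k ^ 2)`, the sine being Lipschitz in the cosine away from ±1. -/
lemma norm_exp_jacobiAngle_sub_le {A B : ℕ → ℝ} {n : ℕ} {x k : ℝ} (hk : k < 1) (h1 : 1 / 2 ≤ A n)
    (h2 : 1 / 2 ≤ A (n + 1)) (hc : |jacobiCos A B n x| ≤ k)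
    (hc' : |jacobiCos A B (n + 1) x| ≤ k) :
    ‖Complex.exp (-(jacobiAngle A B n x) * Complex.I) -
          Complex.exp (-(jacobiAngle A B (n + 1) x) * Complex.I) * (A n / A (n + 1) : ℝ)‖ ≤
      (4 + 2 / √(1 - k ^ 2)) * (|A (n + 1) - A n| + |B (n + 1) - B n|) := by
  have hcos : ∀ m, |jacobiCos A B m x| ≤ k →
      Real.cos (jacobiAngle A B m x) = jacobiCos A B m x := fun m hm =>
    Real.cos_arccos (by linarith [(abs_le.1 hm).1]) (by linarith [(abs_le.1 hm).2])
  have hsin : ∀ m, Real.sin (jacobiAngle A B m x) = √(1 - jacobiCos A B m x ^ 2) := fun m =>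
    Real.sin_arccos _
  have hcc := abs_jacobiCos_succ_sub_le h1 h2 (hc.trans hk.le)
  have hss := abs_sqrt_one_sub_sq_sub_le hk hc hc'
  have hq : |1 - A n / A (n + 1)| ≤ 2 * |A (n + 1) - A n| := by
    have e : 1 - A n / A (n + 1) = (A (n + 1) - A n) / A (n + 1) := by field_simp
    rw [e, abs_div, abs_of_pos (by linarith : 0 < A (n + 1)), div_le_iff₀ (by linarith)]
    have := abs_nonneg (A (n + 1) - A n)
    nlinarith
  have e : Complex.exp (-(jacobiAngle A B n x) * Complex.I) -
          Complex.exp (-(jacobiAngle A B (n + 1) x) * Complex.I) * (A n / A (n + 1) : ℝ) =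
      ((jacobiCos A B n x - jacobiCos A B (n + 1) x : ℝ) : ℂ) +
      (-((√(1 - jacobiCos A B n x ^ 2) - √(1 - jacobiCos A B (n + 1) x ^ 2) : ℝ) : ℂ) * Complex.I +
      Complex.exp (-(jacobiAngle A B (n + 1) x) * Complex.I) * ((1 - A n / A (n + 1) : ℝ) : ℂ)) := by
    rw [exp_neg_mul_I, exp_neg_mul_I, hcos n hc, hcos _ hc', hsin, hsin]
    push_cast
    ring
  rw [e]
  refine (norm_add_le _ _).trans ?_
  refine (add_le_add le_rfl (norm_add_le _ _)).trans ?_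
  rw [norm_mul, norm_mul, norm_exp_neg_mul_I, norm_neg, Complex.norm_I, mul_one, one_mul]
  simp only [Complex.norm_real, Real.norm_eq_abs]
  have hk0 : 0 ≤ k := (abs_nonneg _).trans hc
  have hs : 0 < √(1 - k ^ 2) := Real.sqrt_pos.2 (by nlinarith)
  have h3 : |jacobiCos A B n x - jacobiCos A B (n + 1) x| / √(1 - k ^ 2) ≤
      2 * (|A (n + 1) - A n| + |B (n + 1) - B n|) / √(1 - k ^ 2) := by gcongr
  have h4 := abs_nonneg (B (n + 1) - B n)
  have e2 : (4 + 2 / √(1 - k ^ 2)) * (|A (n + 1) - A n| + |B (n + 1) - B n|) =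
    4 * (|A (n + 1) - A n| + |B (n + 1) - B n|) +
      2 * (|A (n + 1) - A n| + |B (n + 1) - B n|) / √(1 - k ^ 2) := by ring
  rw [e2]
  linarith

/-- The amplitudes are eventually nonvanishing, and relatively equicontinuous, on compact
subintervals of `(-2, 2)`. -/
theorem jacobiAmplitude_relatively_equicontinuous {A B : ℕ → ℝ} {P : ℕ → ℝ → ℝ}
    (hP : ∀ n, Continuous (P n))
    (hrec : ∀ n x, A (n + 1) * P (n + 2) x = (x - B (n + 1)) * P (n + 1) x - A n * P n x)
    (h0 : ∀ n x, P n x = 0 → P (n + 1) x ≠ 0)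
    (hA : Tendsto A atTop (𝓝 1)) (hB : Tendsto B atTop (𝓝 0))
    (hbv : Summable fun n => |A (n + 1) - A n| + |B (n + 1) - B n|)
    {α β : ℝ} (hα : -2 < α) (hβ : β < 2) (N : ℕ) {κ : ℝ} (hκ : 0 < κ) :
    ∃ h > 0, ∀ᶠ n in atTop, ∀ x ∈ Set.Icc α β, ∀ y ∈ Set.Icc α β, |x - y| < h →
      0 < ‖jacobiAmplitude A B P N n y‖ ∧
      ‖jacobiAmplitude A B P N n x - jacobiAmplitude A B P N n y‖ ≤
        κ * ‖jacobiAmplitude A B P N n y‖ := by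
  obtain ⟨k, hk0, hk1, -, hk⟩ := exists_eventually_abs_jacobiCos_le hA hB hα hβ
  have hs : 0 < √(1 - k ^ 2) := Real.sqrt_pos.2 (by nlinarith)
  set s := √(1 - k ^ 2)
  set C := (4 + 2 / s) / s
  have hC : 0 < C := by positivity
  set d : ℕ → ℝ := fun n => C * (|A (n + 1) - A n| + |B (n + 1) - B n|) with hd
  have hd0 : ∀ n, 0 ≤ d n := fun n => by positivity
  have hdsum : Summable d := hbv.mul_left C
  -- The three-term comparison through `F M` below costs (4 + 1 + 2) `T * ‖F M y‖`, and `‖F M y‖ ≤ 2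
  -- * ‖F n y‖`; the total is at most 14/16 of the allowed bound.
  set T := min (1 / 8) (κ / 16) with hT
  have hT0 : 0 < T := by positivity
  have htail : ∀ᶠ M in atTop, ∀ n, ∑ j ∈ Finset.Ico M n, d j ≤ T := by
    have h1 := hdsum.hasSum.tendsto_sum_nat
    filter_upwards [h1.eventually_const_lt (by linarith : (∑' n, d n) - T < ∑' n, d n)] with M hM n
    rcases le_total M n with hMn | hMn
    · rw [Finset.sum_Ico_eq_sub _ hMn]
      have := hdsum.sum_le_tsum (Finset.range n) fun i _ => hd0 i
      linarith
    · simp [Finset.Ico_eq_empty_of_le hMn, hT0.le]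
  have hAev : ∀ᶠ n in atTop, 1 / 2 ≤ A n := hA.eventually_const_le (by norm_num)
  obtain ⟨M, hM⟩ := eventually_atTop.1
    ((hk.and hAev).and (htail.and (eventually_ge_atTop N)))
  have hMM := hM M le_rfl
  set F := jacobiAmplitude A B P N with hF
  have hclose : ∀ n ≥ M, ∀ x ∈ Set.Icc α β, ‖F n x - F M x‖ ≤ 2 * T * ‖F M x‖ := by
    intro n hn x hx
    refine norm_sub_le_of_relative_increments (F := fun n => F n x) hd0
      ((min_le_left _ _).trans (by norm_num)) hMM.2.1 ?_ hn
    intro m hm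
    have hm1 := hM m hm
    have hm2 := hM (m + 1) (hm.le.trans (Nat.le_succ m))
    have hcm := hm1.1.1 x hx
    have hcm' := hm2.1.1 x hx
    have h3 := norm_jacobiAmplitude_succ_sub_le (N := N) hm1.2.2
      (by linarith [hm2.1.2] : 0 < A (m + 1)).ne.symm (hcm'.trans hk1.le) (hrec m x) hs
      (by rw [jacobiAngle, Real.sin_arccos]; exact sqrt_one_sub_sq_le hcm)
      (norm_exp_jacobiAngle_sub_le hk1 hm1.1.2 hm2.1.2 hcm hcm')
    refine h3.trans (le_of_eq ?_)
    simp only [hd, C, hF]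
    ring
  have hFM : ∀ x ∈ Set.Icc α β, 0 < ‖F M x‖ := by
    intro x hx
    rw [hF, norm_jacobiAmplitude, norm_pos_iff]
    refine jacobiWave_ne_zero ?_ (h0 M x)
    rw [jacobiAngle, Real.sin_arccos]
    exact hs.trans_le (sqrt_one_sub_sq_le (hMM.1.1 x hx))
  have hcont : Continuous (F M) := continuous_jacobiAmplitude hP N M
  -- A positive minimum turns the absolute uniform continuity of `F M` into a relative one.
  obtain ⟨m, hm0, hm⟩ : ∃ m > 0, ∀ x ∈ Set.Icc α β, m ≤ ‖F M x‖ := by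
    rcases (Set.Icc α β).eq_empty_or_nonempty with he | hne
    · exact ⟨1, one_pos, by simp [he]⟩
    · obtain ⟨x, hx, hmin⟩ := isCompact_Icc.exists_isMinOn hne hcont.norm.continuousOn
      exact ⟨_, hFM x hx, fun y hy => hmin hy⟩
  obtain ⟨h, hh, hunif⟩ := Metric.uniformContinuousOn_iff.1
    (isCompact_Icc.uniformContinuousOn_of_continuous hcont.continuousOn) (T * m) (by positivity)
  refine ⟨h, hh, ?_⟩
  filter_upwards [eventually_ge_atTop M] with n hn x hx y hy hxy
  have h1 := hclose n hn x hx
  have h2 := hclose n hn y hy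
  have h3 : ‖F M x - F M y‖ < T * m := by
    simpa [dist_eq_norm] using hunif x hx y hy (by simpa [Real.dist_eq] using hxy)
  have h4 := hm y hy
  have hT1 : T ≤ 1 / 8 := min_le_left _ _
  have hT2 : T ≤ κ / 16 := min_le_right _ _
  have h5 : ‖F M y‖ ≤ 2 * ‖F n y‖ := by
    have := norm_sub_norm_le (F M y) (F n y)
    rw [norm_sub_rev] at this
    nlinarith
  have h6 : ‖F M x‖ ≤ 2 * ‖F M y‖ := by
    have := norm_sub_norm_le (F M x) (F M y)
    nlinarith
  refine ⟨by linarith, ?_⟩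
  have e : F n x - F n y = (F n x - F M x) + ((F M x - F M y) - (F n y - F M y)) := by ring
  rw [e]
  have h7 := (norm_add_le (F n x - F M x) ((F M x - F M y) - (F n y - F M y))).trans
    (add_le_add le_rfl (norm_sub_le _ _))
  have h8 : ‖F n x - F M x‖ ≤ 4 * T * ‖F M y‖ := by nlinarith
  have h9 : T * m ≤ T * ‖F M y‖ := by gcongr
  have h10 : T * ‖F M y‖ ≤ κ / 16 * (2 * ‖F n y‖) := by gcongr
  have h11 : 0 ≤ κ * ‖F n y‖ := by positivity
  linarith

/-! ### Slope of the phase. -/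

lemma exists_jacobiAngle_sub_eq {A B : ℕ → ℝ} {n : ℕ} {x y : ℝ} (hA : 0 < A n) (hxy : x < y)
    (hx : -1 < jacobiCos A B n x) (hy : jacobiCos A B n y < 1) :
    ∃ ξ ∈ Set.Ioo (jacobiCos A B n x) (jacobiCos A B n y),
      jacobiAngle A B n x - jacobiAngle A B n y = (y - x) / (2 * A n) * (√(1 - ξ ^ 2))⁻¹ := by
  have hlt : jacobiCos A B n x < jacobiCos A B n y := by
    unfold jacobiCos
    gcongr
  obtain ⟨ξ, hξ, h⟩ := exists_hasDerivAt_eq_slope Real.arccos (fun t => -(1 / √(1 - t ^ 2))) hlt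
    Real.continuous_arccos.continuousOn fun t ht =>
      Real.hasDerivAt_arccos (by linarith [ht.1]) (by linarith [ht.2])
  refine ⟨ξ, hξ, ?_⟩
  have e : jacobiCos A B n y - jacobiCos A B n x = (y - x) / (2 * A n) := by
    unfold jacobiCos
    ring
  rw [eq_div_iff (by linarith : jacobiCos A B n y - jacobiCos A B n x ≠ 0), e] at h
  unfold jacobiAngle
  rw [← one_div]
  linarith

/-- The derivative of arccos is at least 1 in absolute value, and `2 * A n ≤ 4`. -/
lemma jacobiAngle_sub_ge {A B : ℕ → ℝ} {n : ℕ} {x y : ℝ} (hA : 0 < A n) (hA2 : A n ≤ 2)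
    (hxy : x < y) (hx : -1 < jacobiCos A B n x) (hy : jacobiCos A B n y < 1) :
    (y - x) / 4 ≤ jacobiAngle A B n x - jacobiAngle A B n y := by
  obtain ⟨ξ, hξ, h⟩ := exists_jacobiAngle_sub_eq hA hxy hx hy
  have h1 : 1 ≤ (√(1 - ξ ^ 2))⁻¹ := by
    rw [one_le_inv₀ (Real.sqrt_pos.2 (by nlinarith [hξ.1, hξ.2]))]
    exact Real.sqrt_le_one.2 (by nlinarith [sq_nonneg ξ])
  have h2 : (y - x) / 4 ≤ (y - x) / (2 * A n) := by
    apply div_le_div_of_nonneg_left <;> linarith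
  have h3 : 0 ≤ (y - x) / (2 * A n) := div_nonneg (by linarith) (by linarith)
  rw [h]
  nlinarith

/-- The point `t` is free in `[x, y]` because the clock statement evaluates the density at any such
point. -/
lemma jacobiAngle_sub_approx {A B : ℕ → ℝ} (hA : Tendsto A atTop (𝓝 1))
    (hB : Tendsto B atTop (𝓝 0)) {α β : ℝ} (hα : -2 < α) (hβ : β < 2) {κ : ℝ} (hκ : 0 < κ) :
    ∃ h > 0, ∀ᶠ n in atTop, ∀ x ∈ Set.Icc α β, ∀ y ∈ Set.Icc α β, ∀ t ∈ Set.Icc x y, x < y →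
      y - x < h →
      |jacobiAngle A B n x - jacobiAngle A B n y - (y - x) * (√(4 - t ^ 2))⁻¹| ≤ κ * (y - x) := by
  obtain ⟨k, hk0, hk1, hk2, hk⟩ := exists_eventually_abs_jacobiCos_le hA hB hα hβ
  have hs : 0 < √(1 - k ^ 2) := Real.sqrt_pos.2 (by nlinarith)
  have hcont : ContinuousOn (fun c : ℝ => (√(1 - c ^ 2))⁻¹) (Set.Icc (-k) k) := by
    refine ContinuousOn.inv₀ (by fun_prop) fun c hc => ?_
    exact (hs.trans_le (sqrt_one_sub_sq_le (abs_le.2 hc))).ne'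
  obtain ⟨δ, hδ, hunif⟩ := Metric.uniformContinuousOn_iff.1
    (isCompact_Icc.uniformContinuousOn_of_continuous hcont) (κ / 2) (by positivity)
  have hAlim : Tendsto (fun n => |1 / (2 * A n) - 1 / 2| * (√(1 - k ^ 2))⁻¹) atTop (𝓝 0) := by
    have h1 : Tendsto (fun n => 1 / (2 * A n)) atTop (𝓝 (1 / (2 * 1))) :=
      (tendsto_const_nhds).div (hA.const_mul 2) (by norm_num)
    have h2 := ((h1.sub_const (1 / 2)).abs).mul_const (√(1 - k ^ 2))⁻¹
    simpa using h2
  refine ⟨δ, hδ, ?_⟩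
  -- With error `δ / 4` in the cosines and `(y - x) / 2 < δ / 2`, the mean value point `ξ` lies
  -- within `δ` of `t / 2`.
  filter_upwards [hk, eventually_abs_jacobiCos_sub_le hA hB α β (by positivity : 0 < δ / 4),
    hA.eventually_const_lt (by norm_num : (1 / 2 : ℝ) < 1),
    hAlim.eventually_lt_const (by positivity : 0 < κ / 2)] with n hn1 hn2 hn3 hn4 x hx y hy t ht
    hxy hh
  have hxc := abs_le.1 (hn1 x hx)
  have hyc := abs_le.1 (hn1 y hy)
  obtain ⟨ξ, hξ, h⟩ := exists_jacobiAngle_sub_eq (B := B) (by linarith : 0 < A n) hxy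
    (by linarith) (by linarith)
  have htI : t ∈ Set.Icc α β := ⟨hx.1.trans ht.1, ht.2.trans hy.2⟩
  have ht2 := hk2 t htI
  have e4 : (√(4 - t ^ 2))⁻¹ = 1 / 2 * (√(1 - (t / 2) ^ 2))⁻¹ := by
    rw [show 4 - t ^ 2 = 2 ^ 2 * (1 - (t / 2) ^ 2) by ring, Real.sqrt_mul (by norm_num),
      Real.sqrt_sq (by norm_num), mul_inv]
    norm_num
  have hd : |(√(1 - ξ ^ 2))⁻¹ - (√(1 - (t / 2) ^ 2))⁻¹| < κ / 2 := by
    have := hunif ξ ⟨by linarith [hξ.1], by linarith [hξ.2]⟩ (t / 2) (abs_le.1 ht2) (by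
      rw [Real.dist_eq, abs_lt]
      have h1 := abs_le.1 (hn2 x hx)
      have h2 := abs_le.1 (hn2 y hy)
      constructor <;> linarith [hξ.1, hξ.2, ht.1, ht.2])
    simpa [Real.dist_eq] using this
  have hw : (√(1 - (t / 2) ^ 2))⁻¹ ≤ (√(1 - k ^ 2))⁻¹ := inv_anti₀ hs (sqrt_one_sub_sq_le ht2)
  have hw0 : 0 ≤ (√(1 - (t / 2) ^ 2))⁻¹ := by positivity
  have e : jacobiAngle A B n x - jacobiAngle A B n y - (y - x) * (√(4 - t ^ 2))⁻¹ =
      (1 / (2 * A n) * ((√(1 - ξ ^ 2))⁻¹ - (√(1 - (t / 2) ^ 2))⁻¹) +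
        (1 / (2 * A n) - 1 / 2) * (√(1 - (t / 2) ^ 2))⁻¹) * (y - x) := by
    rw [h, e4]
    ring
  rw [e, abs_mul, abs_of_pos (by linarith : 0 < y - x)]
  refine mul_le_mul_of_nonneg_right ?_ (by linarith)
  refine (abs_add_le _ _).trans ?_
  rw [abs_mul, abs_mul, abs_of_nonneg hw0, abs_of_pos (by positivity : 0 < 1 / (2 * A n))]
  have h1 : 1 / (2 * A n) ≤ 1 := by
    rw [div_le_one (by linarith)]
    linarith
  have h2 := mul_le_mul h1 hd.le (abs_nonneg _) zero_le_one
  have h3 := mul_le_mul_of_nonneg_left hw (abs_nonneg (1 / (2 * A n) - 1 / 2))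
  linarith

/-- The phase is summed only from `N` on so that every angle in it obeys the bounds valid for large
index. -/
lemma jacobiPhase_sub_ge {A B : ℕ → ℝ} (hA : Tendsto A atTop (𝓝 1))
    (hB : Tendsto B atTop (𝓝 0)) {α β : ℝ} (hα : -2 < α) (hβ : β < 2) :
    ∀ᶠ N : ℕ in atTop, ∀ n ≥ N, ∀ x ∈ Set.Icc α β, ∀ y ∈ Set.Icc α β, x < y →
      ((n : ℝ) - N) * ((y - x) / 4) ≤ jacobiPhase A B N n x - jacobiPhase A B N n y := by
  obtain ⟨k, hk0, hk1, hk2, hk⟩ := exists_eventually_abs_jacobiCos_le hA hB hα hβ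
  obtain ⟨N₀, hN₀⟩ := eventually_atTop.1 (hk.and ((hA.eventually_const_lt one_pos).and
    (hA.eventually_le_const (by norm_num : (1 : ℝ) < 2))))
  filter_upwards [eventually_ge_atTop N₀] with N hN n hn x hx y hy hxy
  rw [jacobiPhase, jacobiPhase, ← Finset.sum_sub_distrib]
  have h := Finset.card_nsmul_le_sum (Finset.Ico N n)
    (fun j => jacobiAngle A B (j + 1) x - jacobiAngle A B (j + 1) y) ((y - x) / 4) (by
      intro j hj
      obtain ⟨h1, h2, h3⟩ := hN₀ (j + 1) (by have := (Finset.mem_Ico.1 hj).1; omega)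
      exact jacobiAngle_sub_ge h2 h3 hxy (by linarith [(abs_le.1 (h1 x hx)).1])
        (by linarith [(abs_le.1 (h1 y hy)).2]))
  rwa [Nat.card_Ico, nsmul_eq_mul, Nat.cast_sub hn] at h

lemma jacobiPhase_sub_approx {A B : ℕ → ℝ} (hA : Tendsto A atTop (𝓝 1))
    (hB : Tendsto B atTop (𝓝 0)) {α β : ℝ} (hα : -2 < α) (hβ : β < 2) {κ : ℝ} (hκ : 0 < κ) :
    ∃ h > 0, ∀ᶠ N : ℕ in atTop, ∀ n ≥ N, ∀ x ∈ Set.Icc α β, ∀ y ∈ Set.Icc α β, ∀ t ∈ Set.Icc x y,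
      x < y → y - x < h →
      |jacobiPhase A B N n x - jacobiPhase A B N n y -
        ((n : ℝ) - N) * ((y - x) * (√(4 - t ^ 2))⁻¹)| ≤ ((n : ℝ) - N) * (κ * (y - x)) := by
  obtain ⟨h, hh, hev⟩ := jacobiAngle_sub_approx hA hB hα hβ hκ
  obtain ⟨N₀, hN₀⟩ := eventually_atTop.1 hev
  refine ⟨h, hh, ?_⟩
  filter_upwards [eventually_ge_atTop N₀] with N hN n hn x hx y hy t ht hxy hlt
  have e : jacobiPhase A B N n x - jacobiPhase A B N n y -
        ((n : ℝ) - N) * ((y - x) * (√(4 - t ^ 2))⁻¹) =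
      ∑ j ∈ Finset.Ico N n, (jacobiAngle A B (j + 1) x - jacobiAngle A B (j + 1) y -
        (y - x) * (√(4 - t ^ 2))⁻¹) := by
    rw [Finset.sum_sub_distrib, Finset.sum_sub_distrib, Finset.sum_const, Nat.card_Ico,
      nsmul_eq_mul, Nat.cast_sub hn]
    rfl
  rw [e]
  refine (Finset.abs_sum_le_sum_abs _ _).trans ?_
  have h := Finset.sum_le_card_nsmul (Finset.Ico N n)
    (fun j => |jacobiAngle A B (j + 1) x - jacobiAngle A B (j + 1) y -
        (y - x) * (√(4 - t ^ 2))⁻¹|) (κ * (y - x)) (by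
      intro j hj
      exact hN₀ (j + 1) (by have := (Finset.mem_Ico.1 hj).1; omega) x hx y hy t ht hxy hlt)
  rwa [Nat.card_Ico, nsmul_eq_mul, Nat.cast_sub hn] at h

/-! ### Winding of the phase and real values of the wave. -/

/-- If the phase of `F exp (i Φ)` winds by more than a half turn while `F` is almost constant, then
the imaginary part vanishes somewhere. -/
lemma exists_im_eq_zero_of_phase {Φ : ℝ → ℝ} {F : ℝ → ℂ} (hΦ : Continuous Φ) (hF : Continuous F)
    {x y η κ : ℝ} (hη0 : 0 < η) (hxy : x ≤ y)
    (hwind : Real.pi + η ≤ Φ x - Φ y) (hκ : κ < Real.sin (η / 2)) (hFx : 0 < ‖F x‖)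
    (hclose : ∀ s ∈ Set.Icc x y, Φ x - Φ s ≤ Real.pi + η → ‖F s - F x‖ ≤ κ * ‖F x‖) :
    ∃ z ∈ Set.Ioo x y, (F z * Complex.exp (Φ z * Complex.I)).im = 0 := by
  set ω := (F x).arg + Φ x with hω
  -- The frozen argument starts at `ω`, at least `η / 2` above `k * π`, and reaches `k * π - η / 2`
  -- after a drop of less than `π + η`. At `k * π ± η / 2` the sines have opposite signs and size
  -- `sin (η / 2)`, beating the error `κ`.
  set k : ℤ := ⌊(ω - η / 2) / Real.pi⌋ with hk
  have hpi := Real.pi_pos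
  have hk1 : k * Real.pi ≤ ω - η / 2 := by
    rw [← le_div_iff₀ hpi]
    exact Int.floor_le _
  have hk2 : ω - η / 2 < (k + 1) * Real.pi := by
    rw [← div_lt_iff₀ hpi]
    exact Int.lt_floor_add_one _
  set ε : ℝ := (-1) ^ k with hε
  have hε1 : ε = 1 ∨ ε = -1 := by
    rcases Int.even_or_odd k with h | h
    · left; exact h.neg_one_zpow
    · right; exact h.neg_one_zpow
  have hεabs : |ε| = 1 := by rcases hε1 with h | h <;> simp [h]
  have hε2 : ε * ε = 1 := by rcases hε1 with h | h <;> simp [h]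
  set g : ℝ → ℝ := fun s => ε * (F s * Complex.exp (Φ s * Complex.I)).im with hg
  have hgc : Continuous g := by
    have : Continuous fun s => F s * Complex.exp (Φ s * Complex.I) := by fun_prop
    exact continuous_const.mul (Complex.continuous_im.comp this)
  have him : ∀ s ∈ Set.Icc x y, Φ x - Φ s ≤ Real.pi + η →
      |g s - ε * (‖F x‖ * Real.sin ((F x).arg + Φ s))| ≤ κ * ‖F x‖ := by
    intro s hs hs'
    have e : F s * Complex.exp (Φ s * Complex.I) =
        ‖F x‖ * Complex.exp (((F x).arg + Φ s : ℝ) * Complex.I) +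
          (F s - F x) * Complex.exp (Φ s * Complex.I) := by
      conv_lhs => rw [← sub_add_cancel (F s) (F x)]
      rw [add_mul, add_comm]
      congr 1
      conv_lhs => rw [← Complex.norm_mul_exp_arg_mul_I (F x)]
      rw [mul_assoc, ← Complex.exp_add]
      push_cast
      rw [add_mul]
    have e2 : (F s * Complex.exp (Φ s * Complex.I)).im = ‖F x‖ * Real.sin ((F x).arg + Φ s) +
        ((F s - F x) * Complex.exp (Φ s * Complex.I)).im := by
      rw [e, Complex.add_im, Complex.im_ofReal_mul,
        Complex.exp_ofReal_mul_I_im]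
    simp only [hg]
    rw [e2, mul_add, add_sub_cancel_left, abs_mul, hεabs, one_mul]
    refine (Complex.abs_im_le_norm _).trans ?_
    rw [norm_mul, Complex.norm_exp_ofReal_mul_I, mul_one]
    exact hclose s hs hs'
  have hivt : ∀ τ, 0 ≤ τ → τ ≤ Real.pi + η → ∃ s ∈ Set.Icc x y, Φ s = Φ x - τ := by
    intro τ h1 h2
    exact intermediate_value_Icc' hxy hΦ.continuousOn ⟨by linarith, by linarith⟩
  obtain ⟨s₁, hs₁, h₁⟩ := hivt (ω - k * Real.pi - η / 2) (by linarith) (by linarith)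
  obtain ⟨s₂, hs₂, h₂⟩ := hivt (ω - k * Real.pi + η / 2) (by linarith) (by linarith)
  have b₁ := him s₁ hs₁ (by linarith)
  have b₂ := him s₂ hs₂ (by linarith)
  rw [show (F x).arg + Φ s₁ = η / 2 + k * Real.pi by rw [h₁]; ring, Real.sin_add_int_mul_pi] at b₁
  rw [show (F x).arg + Φ s₂ = -(η / 2) + k * Real.pi by rw [h₂]; ring, Real.sin_add_int_mul_pi,
    Real.sin_neg] at b₂
  have c₁ : ε * (‖F x‖ * ((-1) ^ k * Real.sin (η / 2))) = ‖F x‖ * Real.sin (η / 2) := by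
    rw [← hε]
    linear_combination (‖F x‖ * Real.sin (η / 2)) * hε2
  have c₂ : ε * (‖F x‖ * ((-1) ^ k * -Real.sin (η / 2))) = -(‖F x‖ * Real.sin (η / 2)) := by
    rw [← hε]
    linear_combination (-(‖F x‖ * Real.sin (η / 2))) * hε2
  rw [c₁] at b₁
  rw [c₂] at b₂
  have hlt : κ * ‖F x‖ < ‖F x‖ * Real.sin (η / 2) := by nlinarith
  have p₁ : 0 < g s₁ := by linarith [(abs_le.1 b₁).1]
  have p₂ : g s₂ < 0 := by linarith [(abs_le.1 b₂).2]
  -- `Φ` is not assumed monotone, so the order of `s₁` and `s₂` is unknown.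
  obtain ⟨z, hz, hz0⟩ := intermediate_value_uIcc (a := s₁) (b := s₂) hgc.continuousOn
    (Set.mem_uIcc.2 (Or.inr ⟨p₂.le, p₁.le⟩))
  have hz1 : z ≠ s₁ := by
    rintro rfl
    linarith
  have hz2 : z ≠ s₂ := by
    rintro rfl
    linarith
  refine ⟨z, ?_, ?_⟩
  · rcases Set.mem_uIcc.1 hz with h | h
    · exact ⟨lt_of_le_of_lt hs₁.1 (lt_of_le_of_ne h.1 hz1.symm),
        lt_of_lt_of_le (lt_of_le_of_ne h.2 hz2) hs₂.2⟩
    · exact ⟨lt_of_le_of_lt hs₂.1 (lt_of_le_of_ne h.1 hz2.symm),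
        lt_of_lt_of_le (lt_of_le_of_ne h.2 hz1) hs₁.2⟩
  · have hε0 : ε ≠ 0 := by
      rcases hε1 with h | h <;> simp [h]
    exact (mul_eq_zero.1 hz0).resolve_left hε0

/-- If `w exp (-i Δ)` is a negative real number, `w` is close to `1` and `Δ ≥ 0`, then `Δ` is not
much smaller than `π`. -/
lemma pi_sub_le_of_mul_exp_eq_neg {w : ℂ} {Δ η κ ρ : ℝ} (hη0 : 0 < η) (hη : η < Real.pi / 2)
    (hκ : κ ≤ Real.sin η / 3) (hw : ‖w - 1‖ ≤ κ) (hρ : 0 < ρ)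
    (h : w = -ρ * Complex.exp (Δ * Complex.I)) (hΔ0 : 0 ≤ Δ) :
    Real.pi - η ≤ Δ := by
  -- The real part of `w` is near 1, so `cos Δ < 0` and `Δ` lies in (π/2, π - η). Then |Im w| = ρ
  -- sin Δ ≥ (1 - κ) sin η ≥ (2/3) sin η > κ, which is impossible.
  by_contra! hcon
  have hre : w.re = -ρ * Real.cos Δ := by
    rw [h, ← Complex.ofReal_neg, Complex.re_ofReal_mul, Complex.exp_ofReal_mul_I_re]
  have him : w.im = -ρ * Real.sin Δ := by
    rw [h, ← Complex.ofReal_neg, Complex.im_ofReal_mul, Complex.exp_ofReal_mul_I_im]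
  have h1 := (Complex.abs_re_le_norm (w - 1)).trans hw
  have h2 := (Complex.abs_im_le_norm (w - 1)).trans hw
  simp only [Complex.sub_re, Complex.one_re, Complex.sub_im, Complex.one_im, sub_zero] at h1 h2
  have h3 := (abs_le.1 h1).1
  have h4 := (abs_le.1 h2).1
  have hs1 := Real.sin_le_one η
  have hcosneg : Real.cos Δ < 0 := by
    by_contra! hc
    nlinarith
  have hΔ2 : Real.pi / 2 < Δ := by
    by_contra! hc
    exact absurd (Real.cos_nonneg_of_neg_pi_div_two_le_of_le (by linarith [Real.pi_pos]) hc)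
      (not_le.2 hcosneg)
  have hsin : Real.sin η ≤ Real.sin Δ := by
    rw [← Real.sin_pi_sub Δ]
    exact Real.sin_le_sin_of_le_of_le_pi_div_two (by linarith) (by linarith) (by linarith)
  have hsη : 0 < Real.sin η := Real.sin_pos_of_pos_of_lt_pi hη0 (by linarith)
  have hcos := Real.neg_one_le_cos Δ
  have h5 : 1 - κ ≤ ρ := by nlinarith
  nlinarith

/-! ### Clock spacing for solutions of the recursion. -/

/-- `P` solves the Jacobi recursion whose parameters are of bounded variation and tend to the free
ones, and consecutive terms of `P` have no common zeros. -/
structure IsJacobiSolution (A B : ℕ → ℝ) (P : ℕ → ℝ → ℝ) : Prop where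
  continuous : ∀ n, Continuous (P n)
  recurrence : ∀ n x, A (n + 1) * P (n + 2) x = (x - B (n + 1)) * P (n + 1) x - A n * P n x
  no_common_zero : ∀ n x, P n x = 0 → P (n + 1) x ≠ 0
  tendsto_A : Tendsto A atTop (𝓝 1)
  tendsto_B : Tendsto B atTop (𝓝 0)
  summable : Summable fun n => |A (n + 1) - A n| + |B (n + 1) - B n|

/-- The phase decreases at least at the linear rate `(n - N) / 4` on `[α, β]`. -/
def IsSteepFrom (A B : ℕ → ℝ) (α β : ℝ) (N : ℕ) : Prop :=
  ∀ n ≥ N, ∀ x ∈ Set.Icc α β, ∀ y ∈ Set.Icc α β, x < y →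
      ((n : ℝ) - N) * ((y - x) / 4) ≤ jacobiPhase A B N n x - jacobiPhase A B N n y

lemma eventually_mul_sub_gt (N : ℕ) {c K : ℝ} (hc : 0 < c) :
    ∀ᶠ n : ℕ in atTop, K < ((n : ℝ) - N) * c := by
  have h : Tendsto (fun n : ℕ => ((n : ℝ) - N) * c) atTop atTop :=
    (tendsto_atTop_add_const_right _ _ tendsto_natCast_atTop_atTop).atTop_mul_const hc
  exact h.eventually_gt_atTop K

namespace IsJacobiSolution

variable {A B : ℕ → ℝ} {P : ℕ → ℝ → ℝ} {α β : ℝ} {N : ℕ}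

lemma eventually_sin_pos (h : IsJacobiSolution A B P) (hα : -2 < α) (hβ : β < 2) :
    ∀ᶠ n in atTop, ∀ x ∈ Set.Icc α β, 0 < Real.sin (jacobiAngle A B n x) := by
  obtain ⟨k, hk0, hk1, hk2, hk⟩ := exists_eventually_abs_jacobiCos_le h.tendsto_A h.tendsto_B hα hβ
  filter_upwards [hk] with n hn x hx
  rw [jacobiAngle, Real.sin_arccos]
  exact (Real.sqrt_pos.2 (by nlinarith)).trans_le (sqrt_one_sub_sq_le (hn x hx))

/-- For large `n`, steepness puts points with phase drop at most `π + η` within `δ` of each other,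
where the amplitude is almost constant. -/
lemma eventually_exists_zero (h : IsJacobiSolution A B P) (hα : -2 < α) (hβ : β < 2)
    (hN : IsSteepFrom A B α β N) {η : ℝ} (hη0 : 0 < η) (hη : η < Real.pi) :
    ∀ᶠ n in atTop, ∀ x ∈ Set.Icc α β, ∀ y ∈ Set.Icc α β, x < y →
      Real.pi + η ≤ jacobiPhase A B N n x - jacobiPhase A B N n y →
      ∃ z ∈ Set.Ioo x y, P n z = 0 := by
  have hs : 0 < Real.sin (η / 2) :=
    Real.sin_pos_of_pos_of_lt_pi (by linarith) (by linarith)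
  obtain ⟨δ, hδ, hev⟩ := jacobiAmplitude_relatively_equicontinuous h.continuous h.recurrence
    h.no_common_zero h.tendsto_A h.tendsto_B h.summable hα hβ N (half_pos hs)
  filter_upwards [hev, h.eventually_sin_pos hα hβ, eventually_ge_atTop N,
    eventually_mul_sub_gt N (K := Real.pi + η) (by positivity : 0 < δ / 4)]
    with n hn1 hn2 hn3 hn4 x hx y hy hxy hwind
  obtain ⟨z, hz, hz0⟩ := exists_im_eq_zero_of_phase (continuous_jacobiPhase A B N n)
    (continuous_jacobiAmplitude (A := A) (B := B) h.continuous N n) hη0 hxy.le hwind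
    (half_lt_self hs) (hn1 x hx x hx (by simpa using hδ)).1 (by
      intro s hs' hle
      have hsI : s ∈ Set.Icc α β := ⟨hx.1.trans hs'.1, hs'.2.trans hy.2⟩
      refine (hn1 s hsI x hx ?_).2
      rw [abs_of_nonneg (by linarith [hs'.1])]
      rcases hs'.1.eq_or_lt with rfl | hlt
      · simpa using hδ
      · have h1 := hN n hn3 x hx s hsI hlt
        have h2 : 0 ≤ (n : ℝ) - N := by
          rw [sub_nonneg]
          exact_mod_cast hn3
        by_contra! hcon
        have := mul_le_mul_of_nonneg_left
          (div_le_div_of_nonneg_right hcon (by norm_num : (0 : ℝ) ≤ 4)) h2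
        linarith)
  refine ⟨z, hz, ?_⟩
  rw [← jacobiWave_eq_amplitude_mul, jacobiWave_im] at hz0
  exact (mul_eq_zero.1 hz0).resolve_left
    (hn2 z ⟨hx.1.trans hz.1.le, hz.2.le.trans hy.2⟩).ne'

/-- A larger drop would create a zero in between. For the lower bound, the wave at both zeros is
real with opposite signs, so `F y / F x` is a negative multiple of exp(iΔ), Δ being the drop. -/
lemma eventually_abs_phase_sub_pi_le (h : IsJacobiSolution A B P) (hα : -2 < α) (hβ : β < 2)
    (hN : IsSteepFrom A B α β N) {η : ℝ} (hη0 : 0 < η) (hη : η < Real.pi / 2) :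
    ∀ᶠ n in atTop, ∀ x ∈ Set.Icc α β, ∀ y ∈ Set.Icc α β, x < y → P n x = 0 → P n y = 0 →
      (∀ z ∈ Set.Ioo x y, P n z ≠ 0) → P (n + 1) x * P (n + 1) y < 0 →
      |jacobiPhase A B N n x - jacobiPhase A B N n y - Real.pi| ≤ η := by
  have hs : 0 < Real.sin η := Real.sin_pos_of_pos_of_lt_pi (by linarith) (by linarith)
  obtain ⟨δ, hδ, hev⟩ := jacobiAmplitude_relatively_equicontinuous h.continuous h.recurrence
    h.no_common_zero h.tendsto_A h.tendsto_B h.summable hα hβ N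
    (by positivity : 0 < Real.sin η / 3)
  filter_upwards [hev, h.eventually_exists_zero hα hβ hN hη0 (by linarith), eventually_ge_atTop N,
    eventually_mul_sub_gt N (K := Real.pi + η) (by positivity : 0 < δ / 4)]
    with n hn1 hn2 hn3 hn4 x hx y hy hxy hx0 hy0 hno hneg
  have hup : jacobiPhase A B N n x - jacobiPhase A B N n y < Real.pi + η := by
    by_contra! hcon
    obtain ⟨z, hz, hz0⟩ := hn2 x hx y hy hxy hcon
    exact hno z hz hz0
  have h1 := hN n hn3 x hx y hy hxy
  have h2 : 0 ≤ (n : ℝ) - N := by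
    rw [sub_nonneg]
    exact_mod_cast hn3
  have hlt : |y - x| < δ := by
    rw [abs_of_pos (by linarith)]
    by_contra! hcon
    have := mul_le_mul_of_nonneg_left
      (div_le_div_of_nonneg_right hcon (by norm_num : (0 : ℝ) ≤ 4)) h2
    linarith
  obtain ⟨hpos, hclose⟩ := hn1 y hy x hx hlt
  have ex := jacobiWave_eq_amplitude_mul A B P N n x
  have ey := jacobiWave_eq_amplitude_mul A B P N n y
  rw [jacobiWave_of_eq_zero hx0] at ex
  rw [jacobiWave_of_eq_zero hy0] at ey
  set F := jacobiAmplitude A B P N n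
  set Φ := jacobiPhase A B N n
  have hFx : F x ≠ 0 := norm_pos_iff.1 hpos
  have hPx : P (n + 1) x ≠ 0 := fun h0 => by simp [h0] at hneg
  have hlow : Real.pi - η ≤ Φ x - Φ y := by
    refine pi_sub_le_of_mul_exp_eq_neg (w := F y / F x) (ρ := -(P (n + 1) y / P (n + 1) x)) hη0 hη
      le_rfl ?_ ?_ ?_ ?_
    · rw [show F y / F x - 1 = (F y - F x) / F x by field_simp, norm_div, div_le_iff₀ hpos]
      exact hclose
    · have e : P (n + 1) y / P (n + 1) x = (P (n + 1) x * P (n + 1) y) / P (n + 1) x ^ 2 := by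
        field_simp
      rw [e, neg_pos]
      exact div_neg_of_neg_of_pos hneg (by positivity)
    · push_cast
      rw [ex, ey, neg_neg, sub_mul, Complex.exp_sub]
      field_simp
    · refine le_trans ?_ h1
      exact mul_nonneg h2 (by linarith)
  rw [abs_le]
  constructor <;> linarith

theorem eventually_clock (h : IsJacobiSolution A B P) (hα : -2 < α) (hβ : β < 2) {η : ℝ}
    (hη : 0 < η) :
    ∀ᶠ n : ℕ in atTop, ∀ x ∈ Set.Icc α β, ∀ y ∈ Set.Icc α β, x < y → P n x = 0 → P n y = 0 →
      (∀ z ∈ Set.Ioo x y, P n z ≠ 0) → P (n + 1) x * P (n + 1) y < 0 →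
      ∀ t ∈ Set.Icc x y, |(n : ℝ) * (y - x) - Real.pi * √(4 - t ^ 2)| < η := by
  obtain ⟨δ, hδ, hev⟩ := jacobiPhase_sub_approx h.tendsto_A h.tendsto_B hα hβ
    (by positivity : 0 < η / 160)
  obtain ⟨N, hN1, hN2⟩ := (hev.and (jacobiPhase_sub_ge h.tendsto_A h.tendsto_B hα hβ)).exists
  have hpi3 := Real.pi_gt_three
  have hpi4 := Real.pi_lt_four
  filter_upwards [h.eventually_abs_phase_sub_pi_le hα hβ hN2
    (by positivity : 0 < min (η / 16) 1) ((min_le_right _ _).trans_lt (by linarith)),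
    eventually_gt_atTop N, eventually_mul_sub_gt N (K := 20) hδ,
    eventually_mul_sub_gt N (K := 20 * N) (by positivity : 0 < η / 4)]
    with n hn1 hn2 hn3 hn4 x hx y hy hxy hx0 hy0 hno hneg t ht
  have hgap := hn1 x hx y hy hxy hx0 hy0 hno hneg
  have hsteep := hN2 n hn2.le x hx y hy hxy
  have hgap' := abs_le.1 hgap
  have hm1 : min (η / 16) 1 ≤ η / 16 := min_le_left _ _
  have hm2 : min (η / 16) 1 ≤ 1 := min_le_right _ _
  set m : ℝ := (n : ℝ) - N with hm
  have hm0 : 0 < m := by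
    rw [hm, sub_pos]
    exact_mod_cast hn2
  -- Steepness and a drop of at most `π + 1 < 5` give 20. The slope error is then `20 * (η / 160) =
  -- η / 8`; multiplying by `s ≤ 2` gives `3 * η / 8`, and replacing `n - N` by `n` costs another `η
  -- / 4`.
  have hmd : m * (y - x) ≤ 20 := by linarith
  have hlt : y - x < δ := by
    by_contra! hcon
    have := mul_le_mul_of_nonneg_left hcon hm0.le
    linarith
  have happ := abs_le.1 (hN1 n hn2.le x hx y hy t ht hxy hlt)
  rw [← hm] at happ
  have ht2 : 0 < 4 - t ^ 2 := by nlinarith [hx.1, hy.2, ht.1, ht.2]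
  have hs0 : 0 < √(4 - t ^ 2) := Real.sqrt_pos.2 ht2
  have hs2 : √(4 - t ^ 2) ≤ 2 := by
    rw [Real.sqrt_le_left (by norm_num)]
    nlinarith [sq_nonneg t]
  set s := √(4 - t ^ 2)
  have e1 : m * ((y - x) * s⁻¹) - Real.pi = s⁻¹ * (m * (y - x) - Real.pi * s) := by
    field_simp
  have h1 : |s⁻¹ * (m * (y - x) - Real.pi * s)| ≤ η / 16 + η / 8 := by
    rw [← e1, abs_le]
    constructor <;> nlinarith
  rw [abs_mul, abs_of_pos (inv_pos.2 hs0), inv_mul_le_iff₀ hs0] at h1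
  have h2 : |m * (y - x) - Real.pi * s| ≤ 3 * η / 8 := by nlinarith
  have h3 : (N : ℝ) * (y - x) < η / 4 := by
    have h4 : (N : ℝ) * (m * (y - x)) ≤ N * 20 := mul_le_mul_of_nonneg_left hmd (by positivity)
    have h5 : m * ((N : ℝ) * (y - x)) < m * (η / 4) := by linarith
    exact lt_of_mul_lt_mul_left h5 hm0.le
  have h4 : 0 ≤ (N : ℝ) * (y - x) := mul_nonneg (by positivity) (by linarith)
  have e2 : (n : ℝ) * (y - x) = m * (y - x) + N * (y - x) := by
    rw [hm]
    ring
  rw [e2, abs_lt]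
  have h5 := abs_le.1 h2
  constructor <;> linarith

end IsJacobiSolution

/-! ### Counting zeros from below. -/

namespace IsJacobiSolution

variable {A B : ℕ → ℝ} {P : ℕ → ℝ → ℝ}

lemma tendsto_jacobiPhase_div (h : IsJacobiSolution A B P) (N : ℕ) (x : ℝ) :
    Tendsto (fun n : ℕ => jacobiPhase A B N n x / n) atTop (𝓝 (Real.arccos (x / 2))) := by
  have hcos : Tendsto (fun n => jacobiCos A B n x) atTop (𝓝 (x / 2)) := by
    have := (h.tendsto_B.const_sub x).div (h.tendsto_A.const_mul 2) (by norm_num)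
    rw [sub_zero, mul_one] at this
    exact this
  have hang : Tendsto (fun n => jacobiAngle A B (n + 1) x) atTop (𝓝 (Real.arccos (x / 2))) :=
    ((Real.continuous_arccos.tendsto _).comp hcos).comp (tendsto_add_atTop_nat 1)
  have h1 := hang.cesaro
  have h2 : Tendsto (fun n : ℕ => (∑ i ∈ Finset.range N, jacobiAngle A B (i + 1) x) / (n : ℝ)) atTop
      (𝓝 0) := tendsto_const_div_atTop_nhds_zero_nat _
  have h3 := h1.sub h2
  rw [sub_zero] at h3
  refine h3.congr' ?_
  filter_upwards [eventually_ge_atTop N] with n hn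
  rw [jacobiPhase, Finset.sum_Ico_eq_sub _ hn]
  ring

/-- Lower bound for the number of zeros in an interval. -/
theorem eventually_exists_zeros (h : IsJacobiSolution A B P) {c d r : ℝ} (hc : -2 < c) (hcd : c < d)
    (hd : d < 2) (hr : r < (Real.arccos (c / 2) - Real.arccos (d / 2)) / Real.pi) :
    ∀ᶠ n : ℕ in atTop, ∃ S : Finset ℝ, (∀ z ∈ S, z ∈ Set.Ioo c d ∧ P n z = 0) ∧
      r * n ≤ S.card := by
  have hpi := Real.pi_gt_three
  set D := Real.arccos (c / 2) - Real.arccos (d / 2) with hD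
  rw [lt_div_iff₀ (by linarith)] at hr
  obtain ⟨η, hη0, hη1, hrη⟩ : ∃ η > 0, η < 1 ∧ r * (Real.pi + η) < D := by
    have h1 : Tendsto (fun η : ℝ => r * (Real.pi + η)) (𝓝[>] 0) (𝓝 (r * (Real.pi + 0))) :=
      (Continuous.tendsto (by fun_prop) 0).mono_left nhdsWithin_le_nhds
    rw [add_zero] at h1
    obtain ⟨η, h2, h3, h4⟩ := ((h1.eventually_lt_const hr).and
      (Ioo_mem_nhdsGT (by norm_num : (0 : ℝ) < 1))).exists
    exact ⟨η, h3, h4, h2⟩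
  obtain ⟨N, hN⟩ := (jacobiPhase_sub_ge h.tendsto_A h.tendsto_B hc hd).exists
  have hL : 0 < Real.pi + η := by linarith
  set L := Real.pi + η with hLdef
  have hlim : Tendsto (fun n : ℕ => (jacobiPhase A B N n c - jacobiPhase A B N n d) / n / L - 1 / n)
      atTop (𝓝 (D / L)) := by
    have h1 := (((h.tendsto_jacobiPhase_div N c).sub (h.tendsto_jacobiPhase_div N d)).div_const
      L).sub (tendsto_const_div_atTop_nhds_zero_nat 1)
    rw [sub_zero] at h1
    refine h1.congr fun n => ?_
    rw [← sub_div]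
  have hrL : r < D / L := by rwa [lt_div_iff₀ hL]
  filter_upwards [h.eventually_exists_zero hc hd hN hη0 (by linarith), eventually_gt_atTop N,
    hlim.eventually_const_lt hrL] with n hn1 hn2 hn3
  have hn0 : (0 : ℝ) < n := by exact_mod_cast (Nat.zero_le N).trans_lt hn2
  have hm0 : (0 : ℝ) < (n : ℝ) - N := by
    rw [sub_pos]
    exact_mod_cast hn2
  set Φ := jacobiPhase A B N n with hΦ
  have hcont : Continuous Φ := continuous_jacobiPhase A B N n
  have hanti : ∀ x ∈ Set.Icc c d, ∀ y ∈ Set.Icc c d, Φ y < Φ x → x < y := by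
    intro x hx y hy hlt
    by_contra! hcon
    rcases hcon.eq_or_lt with rfl | hyx
    · exact lt_irrefl _ hlt
    · have h1 := hN n hn2.le y hy x hx hyx
      have h2 : 0 < ((n : ℝ) - N) * ((x - y) / 4) := mul_pos hm0 (by linarith)
      linarith
  have hdrop : 0 ≤ Φ c - Φ d := by
    have h1 := hN n hn2.le c ⟨le_rfl, hcd.le⟩ d ⟨hcd.le, le_rfl⟩ hcd
    have h2 : 0 < ((n : ℝ) - N) * ((d - c) / 4) := mul_pos hm0 (by linarith)
    linarith
  -- The interval is cut into `K` pieces of phase drop exactly `L = π + η`, each containing a zero.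
  -- Rounding down loses at most one zero, hence the `1 / n` in `hlim`.
  set K := ⌊(Φ c - Φ d) / L⌋₊ with hK
  have hKle : K * L ≤ Φ c - Φ d := by
    rw [← le_div_iff₀ hL]
    exact Nat.floor_le (by positivity)
  have hKgt : (Φ c - Φ d) / L < K + 1 := Nat.lt_floor_add_one _
  have hX : ∀ k : ℕ, ∃ s, k ≤ K → s ∈ Set.Icc c d ∧ Φ s = Φ c - k * L := by
    intro k
    by_cases hk : k ≤ K
    · have hk' : (k : ℝ) * L ≤ K * L := by gcongr
      obtain ⟨s, hs, hs'⟩ := intermediate_value_Icc' hcd.le hcont.continuousOn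
        (show Φ c - k * L ∈ Set.Icc (Φ d) (Φ c) from
          ⟨by linarith, by linarith [mul_nonneg (Nat.cast_nonneg (α := ℝ) k) hL.le]⟩)
      exact ⟨s, fun _ => ⟨hs, hs'⟩⟩
    · exact ⟨0, fun h => absurd h hk⟩
  choose X hX using hX
  have hXmono : ∀ i j, i < j → j ≤ K → X i < X j := by
    intro i j hij hj
    obtain ⟨h1, h2⟩ := hX i (hij.le.trans hj)
    obtain ⟨h3, h4⟩ := hX j hj
    refine hanti _ h1 _ h3 ?_
    have : (i : ℝ) * L < j * L := by gcongr
    linarith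
  have hz : ∀ k : ℕ, ∃ z, k < K → z ∈ Set.Ioo (X k) (X (k + 1)) ∧ P n z = 0 := by
    intro k
    by_cases hk : k < K
    · obtain ⟨h1, h2⟩ := hX k hk.le
      obtain ⟨h3, h4⟩ := hX (k + 1) hk
      obtain ⟨z, hz, hz0⟩ := hn1 _ h1 _ h3 (hXmono k (k + 1) (Nat.lt_succ_self k) hk) (by
        rw [h2, h4]
        push_cast
        linarith)
      exact ⟨z, fun _ => ⟨hz, hz0⟩⟩
    · exact ⟨0, fun h => absurd h hk⟩
  choose z hz using hz
  have hzmono : ∀ i j, i < j → j < K → z i < z j := by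
    intro i j hij hj
    have h1 := (hz i (hij.trans hj)).1.2
    have h2 := (hz j hj).1.1
    rcases (Nat.succ_le_of_lt hij).eq_or_lt with h3 | h3
    · rw [← h3] at h2 ⊢
      exact h1.trans h2
    · exact h1.trans ((hXmono _ _ h3 hj.le).trans h2)
  refine ⟨(Finset.range K).image z, ?_, ?_⟩
  · intro w hw
    obtain ⟨k, hk, rfl⟩ := Finset.mem_image.1 hw
    have hk := Finset.mem_range.1 hk
    obtain ⟨h1, h2⟩ := hz k hk
    exact ⟨⟨(hX k hk.le).1.1.trans_lt h1.1, h1.2.trans_le (hX (k + 1) hk).1.2⟩, h2⟩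
  · rw [Finset.card_image_of_injOn, Finset.card_range]
    · have e : ((Φ c - Φ d) / n / L - 1 / n) * n = (Φ c - Φ d) / L - 1 := by
        field_simp
      have h1 := mul_lt_mul_of_pos_right hn3 hn0
      rw [e] at h1
      linarith
    · intro i hi j hj hij
      have hi := Finset.mem_range.1 (Finset.mem_coe.1 hi)
      have hj := Finset.mem_range.1 (Finset.mem_coe.1 hj)
      rcases lt_trichotomy i j with h1 | h1 | h1
      · exact absurd hij (hzmono i j h1 hj).ne
      · exact h1
      · exact absurd hij (hzmono j i h1 hi).ne'

end IsJacobiSolution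

/-! ### Weak convergence from lower bounds on interval masses. -/

lemma eq_of_mem_Ioo_grid {L w x : ℝ} (hw : 0 < w) {j k : ℕ}
    (hj : x ∈ Set.Ioo (L + j * w) (L + (j + 1) * w))
    (hk : x ∈ Set.Ioo (L + k * w) (L + (k + 1) * w)) : j = k := by
  have h1 : (j : ℝ) * w < (k + 1) * w := by linarith [hj.1, hk.2]
  have h2 : (k : ℝ) * w < (j + 1) * w := by linarith [hk.1, hj.2]
  have h3 : (j : ℝ) < k + 1 := lt_of_mul_lt_mul_right h1 hw.le
  have h4 : (k : ℝ) < j + 1 := lt_of_mul_lt_mul_right h2 hw.le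
  have h5 : j < k + 1 := by exact_mod_cast h3
  have h6 : k < j + 1 := by exact_mod_cast h4
  omega

lemma sum_indicator_grid {L w x : ℝ} (hw : 0 < w) {m j : ℕ} (hjm : j < m) (t : ℕ → ℝ)
    (hj : x ∈ Set.Ioo (L + j * w) (L + (j + 1) * w)) :
    ∑ k ∈ Finset.range m, (Set.Ioo (L + k * w) (L + (k + 1) * w)).indicator (fun _ => t k) x =
      t j := by
  rw [Finset.sum_eq_single j]
  · exact Set.indicator_of_mem hj _
  · intro k _ hkj
    exact Set.indicator_of_notMem (fun hk => hkj (eq_of_mem_Ioo_grid hw hk hj)) _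
  · intro h
    exact absurd (Finset.mem_range.2 hjm) h

lemma integral_sum_indicator_grid {M : Measure ℝ} [IsFiniteMeasure M] (L w : ℝ) (m : ℕ)
    (t : ℕ → ℝ) :
    Integrable (fun x => ∑ k ∈ Finset.range m,
      (Set.Ioo (L + k * w) (L + (k + 1) * w)).indicator (fun _ => t k) x) M ∧
    ∫ x, ∑ k ∈ Finset.range m,
      (Set.Ioo (L + k * w) (L + (k + 1) * w)).indicator (fun _ => t k) x ∂M =
    ∑ k ∈ Finset.range m, t k * M.real (Set.Ioo (L + k * w) (L + (k + 1) * w)) := by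
  have hi : ∀ k ∈ Finset.range m, Integrable
      (fun x => (Set.Ioo (L + k * w) (L + (k + 1) * w)).indicator (fun _ => t k) x) M :=
    fun k _ => (integrable_const (t k)).indicator measurableSet_Ioo
  refine ⟨integrable_finsetSum _ hi, ?_⟩
  rw [integral_finsetSum _ hi]
  refine Finset.sum_congr rfl fun k _ => ?_
  rw [integral_indicator_const _ measurableSet_Ioo, smul_eq_mul, mul_comm]

/-- For a nonnegative test function, asymptotic lower bounds for the masses of intervals give an
asymptotic lower bound for the integral. -/
lemma eventually_integral_ge_of_nonneg {ν : Measure ℝ} [IsProbabilityMeasure ν] [NullSingletonClass ν]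
    {M : ℕ → Measure ℝ} {L R : ℝ} (hLR : L < R) (hν : ν (Set.Icc L R)ᶜ = 0)
    (hM : ∀ᶠ n in atTop, M n Set.univ ≤ 1)
    (hlow : ∀ c d, L ≤ c → c < d → d ≤ R → ∀ r < ν.real (Set.Ioo c d),
      ∀ᶠ n in atTop, r ≤ (M n).real (Set.Ioo c d))
    (f : ℝ →ᵇ ℝ) (hf : ∀ x, 0 ≤ f x) {ε : ℝ} (hε : 0 < ε) :
    ∀ᶠ n in atTop, ∫ x, f x ∂ν - ε ≤ ∫ x, f x ∂(M n) := by
  obtain ⟨δ, hδ, hunif⟩ := Metric.uniformContinuousOn_iff.1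
    (isCompact_Icc.uniformContinuousOn_of_continuous (f.continuous.continuousOn (s := Set.Icc L R)))
    (ε / 4) (by positivity)
  obtain ⟨m, hm⟩ := exists_nat_gt ((R - L) / δ)
  have hm0 : (0 : ℝ) < m := (div_pos (by linarith) hδ).trans hm
  set w := (R - L) / m with hw
  have hw0 : 0 < w := div_pos (by linarith) hm0
  have hwδ : w < δ := by
    rw [hw, div_lt_iff₀ hm0]
    rw [div_lt_iff₀ hδ] at hm
    linarith
  have hmw : m * w = R - L := by
    rw [hw]
    field_simp
  -- Truncation at 0 keeps the weights nonnegative, so lower bounds on masses can be summed, and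
  -- keeps the step function below `f`.
  set t : ℕ → ℝ := fun k => max (f (L + k * w) - ε / 4) 0 with ht
  have ht0 : ∀ k, 0 ≤ t k := fun k => le_max_right _ _
  set T := ∑ k ∈ Finset.range m, t k with hT
  have hT0 : 0 ≤ T := Finset.sum_nonneg fun k _ => ht0 k
  have hgrid : ∀ k : ℕ, k < m → L ≤ L + k * w ∧ L + k * w < L + (k + 1) * w ∧
      L + (k + 1) * w ≤ R := by
    intro k hk
    have h1 : ((k : ℝ) + 1) * w ≤ m * w := by
      gcongr
      exact_mod_cast hk
    have h2 : 0 ≤ (k : ℝ) * w := by positivity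
    refine ⟨by linarith, by linarith, by linarith⟩
  have hosc : ∀ k : ℕ, k < m → ∀ x ∈ Set.Ioo (L + k * w) (L + (k + 1) * w),
      |f x - f (L + k * w)| < ε / 4 := by
    intro k hk x hx
    obtain ⟨h1, h2, h3⟩ := hgrid k hk
    have := hunif x ⟨h1.trans hx.1.le, hx.2.le.trans h3⟩ (L + k * w) ⟨h1, h2.le.trans h3⟩ (by
      rw [Real.dist_eq, abs_lt]
      constructor <;> linarith [hx.1, hx.2])
    rwa [Real.dist_eq] at this
  have hstep : ∀ x, ∑ k ∈ Finset.range m,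
      (Set.Ioo (L + k * w) (L + (k + 1) * w)).indicator (fun _ => t k) x ≤ f x := by
    intro x
    by_cases hx : ∃ j < m, x ∈ Set.Ioo (L + j * w) (L + (j + 1) * w)
    · obtain ⟨j, hj, hxj⟩ := hx
      rw [sum_indicator_grid hw0 hj t hxj]
      exact max_le (by linarith [(abs_lt.1 (hosc j hj x hxj)).1]) (hf x)
    · push Not at hx
      rw [Finset.sum_eq_zero]
      · exact hf x
      · intro k hk
        exact Set.indicator_of_notMem (hx k (Finset.mem_range.1 hk)) _
  have hstepν : ∀ᵐ x ∂ν, f x ≤ (∑ k ∈ Finset.range m,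
      (Set.Ioo (L + k * w) (L + (k + 1) * w)).indicator (fun _ => t k) x) + ε / 2 := by
    have h1 : ∀ᵐ x ∂ν, x ∈ Set.Icc L R := by
      rw [ae_iff]
      exact hν
    -- Grid points are null for `ν`; `M n` may charge them, but there the step function is 0 and
    -- still below `f`.
    have h2 : ∀ᵐ x ∂ν, ∀ k : ℕ, x ≠ L + k * w := by
      rw [ae_all_iff]
      intro k
      exact compl_mem_ae_iff.2 (measure_singleton _)
    filter_upwards [h1, h2] with x hx1 hx2
    have hq0 : 0 ≤ (x - L) / w := div_nonneg (by linarith [hx1.1]) hw0.le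
    set j := ⌊(x - L) / w⌋₊ with hj
    have hj1 : (j : ℝ) * w ≤ x - L := by
      rw [← le_div_iff₀ hw0]
      exact Nat.floor_le hq0
    have hj2 : x - L < (j + 1) * w := by
      rw [← div_lt_iff₀ hw0]
      exact Nat.lt_floor_add_one _
    have hxj : x ∈ Set.Ioo (L + j * w) (L + (j + 1) * w) :=
      ⟨lt_of_le_of_ne (by linarith) (hx2 j).symm, by linarith⟩
    have hjm : j < m := by
      have h3 : (j : ℝ) * w < m * w := by linarith [hxj.1, hx1.2]
      exact_mod_cast lt_of_mul_lt_mul_right h3 hw0.le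
    rw [sum_indicator_grid hw0 hjm t hxj]
    have h4 := (abs_lt.1 (hosc j hjm x hxj)).2
    have h5 : f (L + j * w) - ε / 4 ≤ t j := le_max_left _ _
    linarith
  have hνint : ∫ x, f x ∂ν ≤ (∑ k ∈ Finset.range m,
      t k * ν.real (Set.Ioo (L + k * w) (L + (k + 1) * w))) + ε / 2 := by
    obtain ⟨hi, he⟩ := integral_sum_indicator_grid (M := ν) L w m t
    have h1 := integral_mono_ae (f.integrable ν) (hi.add (integrable_const (ε / 2))) hstepν
    simp only [Pi.add_apply] at h1
    rw [integral_add hi (integrable_const _), he] at h1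
    simpa using h1
  have hev : ∀ᶠ n in atTop, ∀ k ∈ Finset.range m,
      ν.real (Set.Ioo (L + k * w) (L + (k + 1) * w)) - ε / 2 / (T + 1) ≤
        (M n).real (Set.Ioo (L + k * w) (L + (k + 1) * w)) := by
    rw [Filter.eventually_all_finset]
    intro k hk
    obtain ⟨h1, h2, h3⟩ := hgrid k (Finset.mem_range.1 hk)
    exact hlow _ _ h1 h2 h3 _ (by linarith [show 0 < ε / 2 / (T + 1) by positivity])
  filter_upwards [hev, hM] with n hn hMn
  have : IsFiniteMeasure (M n) := ⟨hMn.trans_lt ENNReal.one_lt_top⟩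
  obtain ⟨hi, he⟩ := integral_sum_indicator_grid (M := M n) L w m t
  have h1 := integral_mono hi (f.integrable (M n)) hstep
  rw [he] at h1
  have h2 : ∑ k ∈ Finset.range m, t k *
      (ν.real (Set.Ioo (L + k * w) (L + (k + 1) * w)) - ε / 2 / (T + 1)) ≤
      ∑ k ∈ Finset.range m, t k * (M n).real (Set.Ioo (L + k * w) (L + (k + 1) * w)) :=
    Finset.sum_le_sum fun k hk => mul_le_mul_of_nonneg_left (hn k hk) (ht0 k)
  simp only [mul_sub] at h2
  rw [Finset.sum_sub_distrib, ← Finset.sum_mul, ← hT] at h2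
  have h3 : T * (ε / 2 / (T + 1)) ≤ ε / 2 := by
    rw [mul_div_assoc', div_le_iff₀ (by linarith)]
    nlinarith
  linarith

/-- Weak convergence of subprobability measures from asymptotic lower bounds for the masses of
intervals. -/
theorem tendsto_integral_of_eventually_measure_Ioo_ge {ν : Measure ℝ} [IsProbabilityMeasure ν]
    [NullSingletonClass ν] {M : ℕ → Measure ℝ} {L R : ℝ} (hLR : L < R) (hν : ν (Set.Icc L R)ᶜ = 0)
    (hM : ∀ᶠ n in atTop, M n Set.univ ≤ 1)
    (hlow : ∀ c d, L ≤ c → c < d → d ≤ R → ∀ r < ν.real (Set.Ioo c d),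
      ∀ᶠ n in atTop, r ≤ (M n).real (Set.Ioo c d)) (f : ℝ →ᵇ ℝ) :
    Tendsto (fun n => ∫ x, f x ∂(M n)) atTop (𝓝 (∫ x, f x ∂ν)) := by
  have key : ∀ (g : ℝ →ᵇ ℝ) {ε : ℝ}, 0 < ε →
      ∀ᶠ n in atTop, ∫ x, g x ∂ν - ε ≤ ∫ x, g x ∂(M n) := by
    intro g ε hε
    -- Adding `‖g‖` makes the function nonnegative; the constant integrates to `‖g‖` against `ν` and
    -- to at most `‖g‖` against `M n`, so it can be removed.
    have h1 := eventually_integral_ge_of_nonneg hLR hν hM hlow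
      (BoundedContinuousFunction.const ℝ ‖g‖ + g) (fun x => by
        have := (abs_le.1 (g.norm_coe_le_norm x)).1
        simp
        linarith) hε
    filter_upwards [h1, hM] with n hn hMn
    have : IsFiniteMeasure (M n) := ⟨hMn.trans_lt ENNReal.one_lt_top⟩
    simp only [BoundedContinuousFunction.coe_add, Pi.add_apply,
      BoundedContinuousFunction.const_apply] at hn
    rw [integral_add (integrable_const _) (g.integrable ν),
      integral_add (integrable_const _) (g.integrable (M n)), integral_const, integral_const] at hn
    have h2 : (M n).real Set.univ ≤ 1 := by
      rw [Measure.real]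
      exact ENNReal.toReal_le_of_le_ofReal zero_le_one (by simpa using hMn)
    simp only [probReal_univ, smul_eq_mul, one_mul] at hn
    have h3 := mul_le_mul_of_nonneg_right h2 (norm_nonneg g)
    linarith
  rw [Metric.tendsto_atTop']
  intro ε hε
  have h1 := key f (half_pos hε)
  -- The lower bound for `-f` is the upper bound for `f`.
  have h2 := key (-f) (half_pos hε)
  obtain ⟨N, hN⟩ := eventually_atTop.1 (h1.and h2)
  refine ⟨N, fun n hn => ?_⟩
  obtain ⟨h3, h4⟩ := hN n hn.le
  simp only [BoundedContinuousFunction.coe_neg, Pi.neg_apply, integral_neg] at h4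
  rw [Real.dist_eq, abs_lt]
  constructor <;> linarith

/-! ### The free density of states. -/

/-- The distribution function of the free density of states, up to a constant. -/
lemma hasDerivAt_neg_arccos_half_div_pi {x : ℝ} (h1 : -2 < x) (h2 : x < 2) :
    HasDerivAt (fun x : ℝ => -(Real.arccos (x / 2)) / Real.pi)
      (Real.pi⁻¹ * (√(4 - x ^ 2))⁻¹) x := by
  have h3 := (Real.hasDerivAt_arccos (x := x / 2) (by linarith) (by linarith)).comp x
    ((hasDerivAt_id x).div_const 2)
  have h4 := h3.neg.div_const Real.pi
  refine h4.congr_deriv ?_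
  rw [show 4 - x ^ 2 = 2 ^ 2 * (1 - (x / 2) ^ 2) by ring, Real.sqrt_mul (by norm_num),
    Real.sqrt_sq (by norm_num), mul_inv]
  field_simp

lemma freeDensityOfStates_Ioo {c d : ℝ} (hc : -2 ≤ c) (hcd : c ≤ d) (hd : d ≤ 2) :
    freeDensityOfStates (Set.Ioo c d) =
      ENNReal.ofReal ((Real.arccos (c / 2) - Real.arccos (d / 2)) / Real.pi) := by
  have hcont : ContinuousOn (fun x : ℝ => -(Real.arccos (x / 2)) / Real.pi) (Set.Icc c d) := by
    have : Continuous fun x : ℝ => Real.arccos (x / 2) :=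
      Real.continuous_arccos.comp (by fun_prop)
    fun_prop
  have hderiv : ∀ x ∈ Set.Ioo c d, HasDerivAt (fun x : ℝ => -(Real.arccos (x / 2)) / Real.pi)
      (Real.pi⁻¹ * (√(4 - x ^ 2))⁻¹) x := fun x hx =>
    hasDerivAt_neg_arccos_half_div_pi (by linarith [hx.1]) (by linarith [hx.2])
  have hnn : ∀ x : ℝ, 0 ≤ Real.pi⁻¹ * (√(4 - x ^ 2))⁻¹ := fun x => by
    have := Real.pi_pos
    positivity
  -- The density may blow up at ±2; integrability comes from its sign and the continuity of the
  -- antiderivative up to the endpoints.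
  have hint := intervalIntegral.integrableOn_deriv_of_nonneg hcont hderiv fun x _ => hnn x
  have hval := intervalIntegral.integral_eq_sub_of_hasDerivAt_of_le hcd hcont hderiv
    ((intervalIntegrable_iff_integrableOn_Ioc_of_le hcd).2 hint)
  have hsub : Set.Ioo c d ⊆ Set.Icc (-2) 2 := fun x hx => ⟨hc.trans hx.1.le, hx.2.le.trans hd⟩
  rw [freeDensityOfStates, withDensity_apply _ measurableSet_Ioo,
    Measure.restrict_restrict measurableSet_Ioo,
    Set.inter_eq_left.2 hsub,
    ← ofReal_integral_eq_lintegral_ofReal (hint.mono_set Set.Ioo_subset_Ioc_self)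
      (Eventually.of_forall hnn), ← integral_Ioc_eq_integral_Ioo,
    ← intervalIntegral.integral_of_le hcd, hval]
  congr 1
  ring

lemma freeDensityOfStates_real_Ioo {c d : ℝ} (hc : -2 ≤ c) (hcd : c ≤ d) (hd : d ≤ 2) :
    freeDensityOfStates.real (Set.Ioo c d) =
      (Real.arccos (c / 2) - Real.arccos (d / 2)) / Real.pi := by
  rw [Measure.real, freeDensityOfStates_Ioo hc hcd hd, ENNReal.toReal_ofReal]
  have := Real.arccos_le_arccos (by linarith : c / 2 ≤ d / 2)
  exact div_nonneg (by linarith) Real.pi_pos.le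

lemma freeDensityOfStates_absolutelyContinuous : freeDensityOfStates ≪ volume :=
  (withDensity_absolutelyContinuous _ _).trans Measure.restrict_le_self.absolutelyContinuous

instance : NullSingletonClass freeDensityOfStates :=
  ⟨fun x => freeDensityOfStates_absolutelyContinuous (measure_singleton x)⟩

lemma freeDensityOfStates_compl_Icc : freeDensityOfStates (Set.Icc (-2) 2)ᶜ = 0 := by
  refine withDensity_absolutelyContinuous _ _ ?_
  rw [Measure.restrict_apply measurableSet_Icc.compl, Set.compl_inter_self, measure_empty]

instance : IsProbabilityMeasure freeDensityOfStates := by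
  constructor
  have h1 : freeDensityOfStates (Set.Icc (-2) 2) = 1 := by
    rw [← measure_congr Ioo_ae_eq_Icc, freeDensityOfStates_Ioo le_rfl (by norm_num) le_rfl]
    norm_num [Real.pi_ne_zero]
  rw [← Set.union_compl_self (Set.Icc (-2 : ℝ) 2), measure_union disjoint_compl_right
    measurableSet_Icc.compl, h1, freeDensityOfStates_compl_Icc, add_zero]

lemma freeDensityOfStates_hasSymmDensityAt {x : ℝ} (h1 : -2 < x) (h2 : x < 2) :
    HasSymmDensityAt freeDensityOfStates (Real.pi⁻¹ * (√(4 - x ^ 2))⁻¹) x := by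
  set G : ℝ → ℝ := fun x => -(Real.arccos (x / 2)) / Real.pi with hG
  set g := Real.pi⁻¹ * (√(4 - x ^ 2))⁻¹
  have hd : HasDerivAt G g x := hasDerivAt_neg_arccos_half_div_pi h1 h2
  have hp : HasDerivAt (fun δ : ℝ => G (x + δ)) g 0 :=
    HasDerivAt.comp_const_add x 0 (by simpa using hd)
  have hm : HasDerivAt (fun δ : ℝ => G (x - δ)) (-g) 0 :=
    HasDerivAt.comp_const_sub x 0 (by simpa using hd)
  have hs := (hasDerivAt_iff_tendsto_slope.1 (hp.sub hm)).mono_left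
    (nhdsWithin_mono 0 (fun y (hy : 0 < y) => hy.ne') : 𝓝[>] (0 : ℝ) ≤ 𝓝[≠] 0)
  have hs2 := hs.div_const 2
  rw [show (g - -g) / 2 = g by ring] at hs2
  refine hs2.congr' ?_
  filter_upwards [Ioo_mem_nhdsGT (lt_min (by linarith : 0 < x + 2) (by linarith : 0 < 2 - x))]
    with δ hδ
  have h3 := hδ.2.trans_le (min_le_left _ _)
  have h4 := hδ.2.trans_le (min_le_right _ _)
  have h0 : 0 < δ := hδ.1
  rw [freeDensityOfStates_real_Ioo (by linarith) (by linarith) (by linarith), slope_def_field]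
  simp only [Pi.sub_apply, hG, add_zero, sub_zero, sub_self]
  field_simp
  ring

/-! ### Sign alternation at successive zeros and the Christoffel–Darboux kernel. -/

lemma exists_mem_Ioo_pos_of_deriv_pos {f : ℝ → ℝ} {f' x c : ℝ} (hf : HasDerivAt f f' x)
    (hx : f x = 0) (hf' : 0 < f') (hc : x < c) : ∃ z ∈ Set.Ioo x c, 0 < f z := by
  have hs := (hasDerivAt_iff_tendsto_slope.1 hf).mono_left
    (nhdsWithin_mono x (fun y (hy : x < y) => hy.ne') : 𝓝[>] x ≤ 𝓝[≠] x)
  obtain ⟨z, hz, hz'⟩ := ((hs.eventually_const_lt hf').and (Ioo_mem_nhdsGT hc)).exists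
  refine ⟨z, hz', ?_⟩
  rw [slope_def_field, hx, sub_zero] at hz
  exact (div_pos_iff_of_pos_right (by linarith [hz'.1])).1 hz

/-- At successive zeros the derivatives do not have the same sign. -/
lemma deriv_mul_deriv_nonpos_of_successive_zeros {f f' : ℝ → ℝ} (hf : ∀ x, HasDerivAt f (f' x) x)
    {x y : ℝ} (hxy : x < y) (hx : f x = 0) (hy : f y = 0) (hno : ∀ z ∈ Set.Ioo x y, f z ≠ 0) :
    f' x * f' y ≤ 0 := by
  have key : ∀ g g' : ℝ → ℝ, (∀ x, HasDerivAt g (g' x) x) → g x = 0 → g y = 0 →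
      (∀ z ∈ Set.Ioo x y, g z ≠ 0) → 0 < g' x → 0 < g' y → False := by
    intro g g' hg hgx hgy hno h1 h2
    obtain ⟨u, hu, hu'⟩ := exists_mem_Ioo_pos_of_deriv_pos (hg x) hgx h1 hxy
    -- Reflection through the origin reduces the left side of `y` to the one-sided lemma.
    have hg2 : HasDerivAt (fun t => -g (-t)) (g' y) (-y) := by
      have h3 : HasDerivAt g (g' y) (-(-y)) := by simpa using hg y
      exact (h3.comp (-y) (hasDerivAt_neg (-y))).neg.congr_deriv (by ring)
    obtain ⟨v, hv, hv'⟩ := exists_mem_Ioo_pos_of_deriv_pos hg2 (by simpa using hgy) h2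
      (by linarith [hu.2] : -y < -u)
    have hc : Continuous g := continuous_iff_continuousAt.2 fun t => (hg t).continuousAt
    obtain ⟨z, hz, hz0⟩ := intermediate_value_Icc' (by linarith [hv.2] : u ≤ -v) hc.continuousOn
      (show (0 : ℝ) ∈ Set.Icc (g (-v)) (g u) from ⟨by linarith, hu'.le⟩)
    exact hno z ⟨by linarith [hz.1, hu.1], by linarith [hz.2, hv.1]⟩ hz0
  by_contra! hcon
  rcases mul_pos_iff.1 hcon with ⟨h1, h2⟩ | ⟨h1, h2⟩
  · exact key f f' hf hx hy hno h1 h2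
  · exact key (fun t => -f t) (fun t => -f' t) (fun t => (hf t).neg) (by simp [hx]) (by simp [hy])
      (fun z hz => neg_ne_zero.2 (hno z hz)) (by linarith) (by linarith)

section JacobiParameters

variable {μ : Measure ℝ} {p : ℕ → ℝ[X]} {a b : ℕ → ℝ}

/-- Compare the coefficients of degree `n + 1` in the recursion. -/
lemma IsJacobiParameters.pos (hp : IsOrthonormalPolynomials μ p) (hab : IsJacobiParameters p a b)
    (n : ℕ) : 0 < a (n + 1) := by
  have hcoeff : ∀ m, 0 < (p m).coeff m := fun m => by
    have := hp.leadingCoeff_pos m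
    rwa [leadingCoeff, hp.natDegree_eq] at this
  have hzero : ∀ m k, m < k → (p m).coeff k = 0 := fun m k h =>
    coeff_eq_zero_of_natDegree_lt (by rwa [hp.natDegree_eq])
  have key : (p n).coeff n = a (n + 1) * (p (n + 1)).coeff (n + 1) := by
    rcases n with _ | n
    · have h := congrArg (fun q => coeff q 1) hab.rec_zero
      simpa [coeff_X_mul, hzero 0 1 one_pos] using h
    · have h := congrArg (fun q => coeff q (n + 2)) (hab.rec_succ n)
      simp only [coeff_X_mul, coeff_add, coeff_C_mul] at h
      rw [hzero (n + 1) (n + 2) (by omega), hzero n (n + 2) (by omega)] at h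
      simpa using h
  have h1 := hcoeff n
  rw [key] at h1
  exact pos_of_mul_pos_left h1 (hcoeff (n + 1)).le

/-- The confluent Christoffel–Darboux kernel is positive. -/
lemma IsJacobiParameters.wronskian_pos (hp : IsOrthonormalPolynomials μ p)
    (hab : IsJacobiParameters p a b) (n : ℕ) (x : ℝ) :
    0 < a (n + 1) * ((derivative (p (n + 1))).eval x * (p n).eval x -
      (derivative (p n)).eval x * (p (n + 1)).eval x) := by
  induction n with
  | zero =>
    have h0 : p 0 = C ((p 0).coeff 0) := eq_C_of_natDegree_eq_zero (hp.natDegree_eq 0)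
    have hd : derivative (p 0) = 0 := by
      rw [h0, derivative_C]
    have hpos : (p 0).eval x ≠ 0 := by
      have := hp.leadingCoeff_pos 0
      rw [h0, leadingCoeff_C] at this
      rw [h0, eval_C]
      exact this.ne'
    have h := congrArg (fun q => (derivative q).eval x) hab.rec_zero
    simp only [derivative_mul, derivative_X, derivative_add, derivative_C, hd, eval_add, eval_mul,
      eval_C, eval_X, eval_one, eval_zero] at h
    have e : a (0 + 1) * ((derivative (p (0 + 1))).eval x * (p 0).eval x -
      (derivative (p 0)).eval x * (p (0 + 1)).eval x) = (p 0).eval x ^ 2 := by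
      rw [hd, eval_zero]
      simp only [zero_add]
      linear_combination (-(p 0).eval x) * h
    rw [e]
    positivity
  | succ n ih =>
    have h1 := congrArg (fun q => q.eval x) (hab.rec_succ n)
    have h2 := congrArg (fun q => (derivative q).eval x) (hab.rec_succ n)
    simp only [derivative_mul, derivative_X, derivative_add, derivative_C, eval_add, eval_mul,
      eval_C, eval_X, eval_one, eval_zero] at h1 h2
    -- The recursion and its derivative show that each step adds a square.
    have e : a (n + 1 + 1) * ((derivative (p (n + 1 + 1))).eval x * (p (n + 1)).eval x -
      (derivative (p (n + 1))).eval x * (p (n + 1 + 1)).eval x) =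
      a (n + 1) * ((derivative (p (n + 1))).eval x * (p n).eval x -
      (derivative (p n)).eval x * (p (n + 1)).eval x) + (p (n + 1)).eval x ^ 2 := by
      simp only [show n + 1 + 1 = n + 2 from rfl]
      linear_combination (derivative (p (n + 1))).eval x * h1 - (p (n + 1)).eval x * h2
    rw [e]
    positivity

/-- The shift by one makes the indices start at 0 and discards the meaningless `a 0` and `b 0`. -/
lemma IsJacobiParameters.isJacobiSolution (hp : IsOrthonormalPolynomials μ p)
    (hab : IsJacobiParameters p a b) (ha : Tendsto a atTop (𝓝 1)) (hb : Tendsto b atTop (𝓝 0))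
    (hbv : Summable (fun n : ℕ => |a (n + 2) - a (n + 1)| + |b (n + 2) - b (n + 1)|)) :
    IsJacobiSolution (fun n => a (n + 1)) (fun n => b (n + 1)) (fun n x => (p n).eval x) where
  continuous n := (p n).continuous
  recurrence n x := by
    have h1 := congrArg (fun q => q.eval x) (hab.rec_succ n)
    simp only [eval_add, eval_mul, eval_C, eval_X] at h1
    linarith
  no_common_zero n x h0 h1 := by
    have := hab.wronskian_pos hp n x
    rw [h0, h1] at this
    simp at this
  tendsto_A := ha.comp (tendsto_add_atTop_nat 1)
  tendsto_B := hb.comp (tendsto_add_atTop_nat 1)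
  summable := hbv

/-- At a zero of `p n`, the positive kernel makes `p (n + 1)` and the derivative of `p n` nonzero of
opposite signs, and these derivatives alternate. -/
lemma IsJacobiParameters.eval_succ_mul_neg_of_successive_zeros (hp : IsOrthonormalPolynomials μ p)
    (hab : IsJacobiParameters p a b) {n : ℕ} {x y : ℝ} (hxy : x < y) (hx : (p n).eval x = 0)
    (hy : (p n).eval y = 0) (hno : ∀ z ∈ Set.Ioo x y, (p n).eval z ≠ 0) :
    (p (n + 1)).eval x * (p (n + 1)).eval y < 0 := by
  have hd := deriv_mul_deriv_nonpos_of_successive_zeros (fun t => (p n).hasDerivAt t) hxy hx hy hno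
  have h1 := hab.wronskian_pos hp n x
  have h2 := hab.wronskian_pos hp n y
  have h0 := hab.pos hp n
  rw [hx, mul_zero, zero_sub] at h1
  rw [hy, mul_zero, zero_sub] at h2
  have h3 := pos_of_mul_pos_right h1 h0.le
  have h4 := pos_of_mul_pos_right h2 h0.le
  have h5 := mul_pos h3 h4
  by_contra! hcon
  nlinarith [mul_nonneg hcon (neg_nonneg.2 hd)]

end JacobiParameters

/-! ### Zero measures and conclusion. -/

lemma sum_map_dirac_apply (s : Multiset ℝ) {t : Set ℝ} [DecidablePred (· ∈ t)]
    (ht : MeasurableSet t) :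
    (s.map Measure.dirac).sum t = (s.countP (· ∈ t) : ENNReal) := by
  induction s using Multiset.induction_on with
  | empty => simp
  | cons x s ih =>
    rw [Multiset.map_cons, Multiset.sum_cons, Measure.add_apply, ih, Measure.dirac_apply' _ ht,
      Multiset.countP_cons]
    by_cases hx : x ∈ t
    · simp [hx, add_comm]
    · simp [hx]

lemma zeroMeasure_univ_le {p : ℕ → ℝ[X]} {n : ℕ} (hp : (p n).natDegree = n) (hn : n ≠ 0) :
    zeroMeasure p n Set.univ ≤ 1 := by
  rw [zeroMeasure, Measure.smul_apply, sum_map_dirac_apply _ MeasurableSet.univ, smul_eq_mul,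
    ← ENNReal.inv_mul_cancel (by exact_mod_cast hn) (ENNReal.natCast_ne_top n)]
  gcongr
  exact (Multiset.countP_le_card _ _).trans ((card_roots' _).trans hp.le)

lemma le_zeroMeasure_real {p : ℕ → ℝ[X]} {n : ℕ} (hp : (p n).natDegree = n) (hn : n ≠ 0)
    {t : Set ℝ} (ht : MeasurableSet t) {S : Finset ℝ} (hS : ∀ z ∈ S, z ∈ t ∧ (p n).eval z = 0)
    {r : ℝ} (hr : r * n ≤ S.card) : r ≤ (zeroMeasure p n).real t := by
  classical
  have hp0 : p n ≠ 0 := by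
    intro h
    rw [h, natDegree_zero] at hp
    exact hn hp.symm
  rw [Measure.real, zeroMeasure, Measure.smul_apply, sum_map_dirac_apply _ ht, smul_eq_mul,
    ENNReal.toReal_mul, ENNReal.toReal_inv, ENNReal.toReal_natCast, ENNReal.toReal_natCast]
  have h1 : S.val ≤ (p n).roots := by
    rw [Multiset.le_iff_subset S.nodup]
    intro z hz
    exact (mem_roots hp0).2 (hS z hz).2
  have h2 : S.card ≤ (p n).roots.countP (· ∈ t) := by
    have h3 := Multiset.countP_le_of_le (· ∈ t) h1
    rwa [Multiset.countP_eq_card.2 fun z hz => (hS z hz).1] at h3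
  have hn0 : (0 : ℝ) < n := by exact_mod_cast Nat.pos_of_ne_zero hn
  rw [inv_mul_eq_div, le_div_iff₀ hn0]
  exact hr.trans (by exact_mod_cast h2)

/-- The zero count needs endpoints strictly inside (-2, 2); shrinking the interval slightly covers
endpoints ±2. -/
lemma exists_lt_arccos_sub_of_lt {c d r : ℝ} (hcd : c < d)
    (hr : r < (Real.arccos (c / 2) - Real.arccos (d / 2)) / Real.pi) :
    ∃ c' d', c < c' ∧ c' < d' ∧ d' < d ∧
      r < (Real.arccos (c' / 2) - Real.arccos (d' / 2)) / Real.pi := by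
  have hc : Continuous fun δ : ℝ =>
      (Real.arccos ((c + δ) / 2) - Real.arccos ((d - δ) / 2)) / Real.pi := by
    have h1 : Continuous fun δ : ℝ => Real.arccos ((c + δ) / 2) :=
      Real.continuous_arccos.comp (by fun_prop)
    have h2 : Continuous fun δ : ℝ => Real.arccos ((d - δ) / 2) :=
      Real.continuous_arccos.comp (by fun_prop)
    fun_prop
  have h1 := (hc.tendsto 0).mono_left (nhdsWithin_le_nhds (s := Set.Ioi 0))
  simp only [add_zero, sub_zero] at h1
  obtain ⟨δ, h2, h3, h4⟩ := ((h1.eventually_const_lt hr).and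
    (Ioo_mem_nhdsGT (by linarith : 0 < (d - c) / 2))).exists
  exact ⟨c + δ, d - δ, by linarith, by linarith, by linarith, h2⟩

theorem theorem1p4 (μ : Measure ℝ) (p : ℕ → ℝ[X]) (a b : ℕ → ℝ)
    (hp : IsOrthonormalPolynomials μ p) (hab : IsJacobiParameters p a b)
    (ha : Tendsto a atTop (𝓝 1)) (hb : Tendsto b atTop (𝓝 0))
    (hbv : Summable (fun n : ℕ => |a (n + 2) - a (n + 1)| + |b (n + 2) - b (n + 1)|)) :
    IsDensityOfStates p freeDensityOfStates ∧
      ∀ ε : ℝ, 0 < ε → UniformClockBehavior p freeDensityOfStates (-2 + ε) (2 - ε) := by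
  have hsol := hab.isJacobiSolution hp ha hb hbv
  refine ⟨⟨inferInstance, ?_⟩, ?_⟩
  · refine tendsto_integral_of_eventually_measure_Ioo_ge (by norm_num : (-2 : ℝ) < 2)
      freeDensityOfStates_compl_Icc ?_ ?_
    · filter_upwards [eventually_ne_atTop 0] with n hn
      exact zeroMeasure_univ_le (hp.natDegree_eq n) hn
    · intro c d hc hcd hd r hr
      rw [freeDensityOfStates_real_Ioo hc hcd.le hd] at hr
      obtain ⟨c', d', h1, h2, h3, h4⟩ := exists_lt_arccos_sub_of_lt hcd hr
      filter_upwards [hsol.eventually_exists_zeros (by linarith) h2 (by linarith) h4,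
        eventually_ne_atTop 0] with n hn hn0
      obtain ⟨S, hS, hcard⟩ := hn
      exact le_zeroMeasure_real (hp.natDegree_eq n) hn0 measurableSet_Ioo
        (fun z hz => ⟨⟨h1.trans (hS z hz).1.1, (hS z hz).1.2.trans h3⟩, (hS z hz).2⟩) hcard
  · intro ε hε
    have hpos : ∀ x ∈ Set.Icc (-2 + ε) (2 - ε), 0 < √(4 - x ^ 2) := fun x hx =>
      Real.sqrt_pos.2 (by nlinarith [hx.1, hx.2])
    refine ⟨fun x => Real.pi⁻¹ * (√(4 - x ^ 2))⁻¹, ?_, ?_, ?_, ?_⟩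
    · intro x hx
      exact freeDensityOfStates_hasSymmDensityAt (by linarith [hx.1]) (by linarith [hx.2])
    · exact continuousOn_const.mul
        (ContinuousOn.inv₀ (by fun_prop) fun x hx => (hpos x hx).ne')
    · intro x hx
      exact mul_ne_zero (inv_ne_zero Real.pi_ne_zero) (inv_ne_zero (hpos x hx).ne')
    · intro η hη
      obtain ⟨N, hN⟩ := eventually_atTop.1
        (hsol.eventually_clock (by linarith : -2 < -2 + ε) (by linarith : 2 - ε < 2) hη)
      refine ⟨N, fun n hn E' E hz x hx => ?_⟩
      obtain ⟨h1, h2, h3, h4, h5, h6⟩ := hz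
      rw [mul_inv, inv_inv, inv_inv]
      exact hN n hn E' h1 E h2 h3 h4 h5 h6
        (hab.eval_succ_mul_neg_of_successive_zeros hp h3 h4 h5 h6) x hx
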